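/- Let $d\ge 2$, let $\sigma$ be the surface measure on the unit sphere $\mathbb S^{d-1}\subset\mathbb R^d$, and $H^+=\{s\in\mathbb S^{d-1}: s_1\ge 0\}$. For a function $f$ on $\mathbb S^{d-1}$ put $f^-(\theta)=(f(\theta)-f(-\theta))/2$ and, if $f$ is integrable, $\mathcal H[f](s)=\int_{\langle s,\theta\rangle\ge 0}f(\theta)\,d\sigma(\theta)$. Model. On a probability space there are random elements $X$, $Z\in\mathbb R^{d-1}$, $A\in\mathbb R$, $B\in\mathbb R^{d-1}$ and $Y\in\mathcal Y$, where $\mathcal Y\subset\mathbb R$ is a given Borel set. Put $\Gamma=(A,B)/\|(A,B)\|$ (and $\Gamma=0$ if $(A,B)=0$), $S=(1,Z)/\|(1,Z)\|$, and $R=1\{A+B^\top Z>0\}=1\{\Gamma^\top S>0\}$. The observed data are $(X,Z,R,RY)$. All statements for $x$ below are for almost every $x$ with respect to the law of $X$, and given $X=x$. Assume: (i) $\Gamma\neq0$ almost surely; (ii) $S$ is independent of $(\Gamma,Y)$; (iii) $\Gamma$ has a density $f_{\Gamma|X=x}\in L^2(\mathbb S^{d-1})$ with respect to $\sigma$; (iv)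 $f_{\Gamma|X=x}(\gamma)f_{\Gamma|X=x}(-\gamma)=0$ for $\sigma$-a.e. $\gamma$. For each $x$ let $\Phi_x$ be an identifying class, that is, a set of measurable functions $\phi:\mathbb R\to\mathbb R$ whose integrals determine every finite Borel measure carried by $\mathcal Y$ for which they are integrable, and let the $\phi\in\Phi_x$ be nonnegative a.e. and integrable for the law of $Y$ given $X=x$. Let $\mathcal C_x$ be a quasi-analytic class, that is, a set of $C^\infty$ functions on $\mathbb S^{d-1}$ such that two members with the same value and the same derivatives of all orders at one point are equal. Put $r_{\phi,x}(\gamma)=\mathbb E[\phi(Y)|X=x,\Gamma=\gamma]\,f_{\Gamma|X=x}(\gamma)$ and $g_{\phi,x}=\mathcal H[r_{\phi,x}]$. Assume finally that either (v) the support of $S$ given $X=x$ is $H^+$, or (v') the support of $S$ given $X=x$ has nonempty interior in $\mathbb S^{d-1}$, and $g_{\phi,x}\in\mathcal C_x$ for all $\phi\in\Phi_x$. Then: (1) For all $\phi\in\Phi_x$, $r_{\phi,x}^-$ is identified, and the joint law of $(Y,\Gamma)$ given $X=x$ is identified: any two models that satisfy these restrictions (with the same $\mathcal Y,\Phi_x,\mathcal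 C_x$) and have the same law of the observed data have, for almost every $x$, the same $r_{\phi,x}^-$ ($\sigma$-a.e., for all $\phi\in\Phi_x$) and the same law of $(Y,\Gamma)$ given $X=x$. (2) For all $\phi\in\Phi_x$, $r^-_{\phi,x}$ is, up to a.e. equality, the unique odd integrable function $h$ with $\mathcal H[h]=g^-_{\phi,x}$, and $r_{\phi,x}=2r^-_{\phi,x}1\{r^-_{\phi,x}>0\}$ $\sigma$-a.e. (3) Suppose (v), and that $S$ given $X=x$ has a density $f_{S|X=x}$ with respect to $\sigma$ which is positive $\sigma$-a.e. on $H^+$. Then for all $\phi\in\Phi_x$, $\gamma\in\mathbb S^{d-1}$ and $p\in\mathbb N_0$, the following integrals exist and $$\int_{\mathbb S^{d-1}}q_{2p+1,d}(\gamma^\top s)g_{\phi,x}(s)\,d\sigma(s)=2\,\mathbb E\left[\left.\frac{q_{2p+1,d}(\gamma^\top S)}{f_{S|X=x}(S)}\phi(Y)R\right|X=x\right]-\mathbb E[\phi(Y)|X=x]\int_{H^+}q_{2p+1,d}(\gamma^\top s)\,d\sigma(s).$$ Here $$q_{k,d}(t)=\frac{L(k,d)\,C_k^{(d-2)/2}(t)}{|\mathbb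 S^{d-1}|\,C_k^{(d-2)/2}(1)},\qquad L(k,d)=\frac{(2k+d-2)\,(k+d-2)!}{k!\,(d-2)!\,(k+d-2)},$$ and $C_k^\mu$ are the Gegenbauer polynomials (with $C_k^0=\frac2kT_k$ for $k\ge1$, $T_k$ the Chebyshev polynomials). -/

import Mathlib

open MeasureTheory ProbabilityTheory Set
open scoped Manifold

universe u v

noncomputable section

/-! ### The sphere `𝕊^{d-1}` in `ℝ^d`, with `d = n + 1`, and its surface measure -/

/-- The unit sphere of `ℝ^(n+1)`. -/
abbrev USphere (n : ℕ) : Type := Metric.sphere (0 : EuclideanSpace ℝ (Fin (n + 1))) 1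

instance factFinrankEuclidean (n : ℕ) :
    Fact (Module.finrank ℝ (EuclideanSpace ℝ (Fin (n + 1))) = n + 1) :=
  ⟨by simp⟩

instance nonemptyUSphere (n : ℕ) : Nonempty (USphere n) :=
  (NormedSpace.sphere_nonempty (x := (0 : EuclideanSpace ℝ (Fin (n + 1)))) (r := 1)).2
    zero_le_one |>.to_subtype

/-- The spherical (surface) measure `σ`. -/
def sphMeasure (n : ℕ) : Measure (USphere n) :=
  (volume : Measure (EuclideanSpace ℝ (Fin (n + 1)))).toSphere

/-- The closed half-sphere `H⁺` of points with nonnegative first coordinate. -/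
def upperHalfSphere (n : ℕ) : Set (USphere n) :=
  {s | 0 ≤ (s : EuclideanSpace ℝ (Fin (n + 1))) 0}

/-- The odd part `f⁻`. -/
def oddPart {n : ℕ} (f : USphere n → ℝ) : USphere n → ℝ :=
  fun θ => (f θ - f (-θ)) / 2

/-- The hemispherical transform. -/
def hemispherical {n : ℕ} (f : USphere n → ℝ) : USphere n → ℝ :=
  fun s => ∫ θ in {θ : USphere n | 0 ≤ inner ℝ (s : EuclideanSpace ℝ (Fin (n + 1))) θ},
    f θ ∂(sphMeasure n)

/-! ### Gegenbauer polynomials -/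

/-- The Gegenbauer polynomials `C_k^μ`. For `μ = 0` these are `C_0^0 = 1` and
`C_k^0 = (2 / k) T_k` for `k ≥ 1`, with `T_k` the Chebyshev polynomials; in that case the first
step of the three-term recursion has the coefficient `2` in front of `C_0^0`. -/
def gegenbauer (μ : ℝ) : ℕ → ℝ → ℝ
  | 0, _ => 1
  | 1, t => if μ = 0 then 2 * t else 2 * μ * t
  | k + 2, t =>
      (2 * (μ + k + 1) * t * gegenbauer μ (k + 1) t
        - (if μ = 0 ∧ k = 0 then 2 else 2 * μ + k) * gegenbauer μ k t) / (k + 2)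

/-- `L(k, d)`, the dimension of the space of spherical harmonics of degree `k` on `𝕊^{d-1}`,
for `d ≥ 2` and `k ≥ 1`. -/
def harmonicDim (k d : ℕ) : ℝ :=
  (2 * k + d - 2 : ℝ) * (k + d - 2).factorial
    / (k.factorial * (d - 2).factorial * (k + d - 2 : ℝ))

/-- The zonal kernel `q_{k,d}` with `d = n + 1`. -/
def zonalKernel (n k : ℕ) (t : ℝ) : ℝ :=
  harmonicDim k (n + 1) * gegenbauer (((n + 1 : ℝ) - 2) / 2) k t
    / ((sphMeasure n).real univ * gegenbauer (((n + 1 : ℝ) - 2) / 2) k 1)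

/-! ### Identifying classes and quasi-analytic classes -/

/-- `Φ` is an identifying class for laws carried by `𝒴`: it consists of measurable functions whose
integrals determine every finite Borel measure carried by `𝒴` (for which they are integrable). -/
def IsIdentifyingClass (𝒴 : Set ℝ) (Φ : Set (ℝ → ℝ)) : Prop :=
  (∀ φ ∈ Φ, Measurable φ) ∧
    ∀ μ ν : Measure ℝ, IsFiniteMeasure μ → IsFiniteMeasure ν → μ 𝒴ᶜ = 0 → ν 𝒴ᶜ = 0 →
      (∀ φ ∈ Φ, Integrable φ μ ∧ Integrable φ ν ∧ ∫ y, φ y ∂μ = ∫ y, φ y ∂ν) → μ = ν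

/-- `f` and `g` have the same value and the same derivatives of all orders at `s`, read in the
chart of the sphere around `s`. -/
def SameJetAt {n : ℕ} (f g : USphere n → ℝ) (s : USphere n) : Prop :=
  ∀ k : ℕ,
    iteratedFDeriv ℝ k (f ∘ (extChartAt (𝓡 n) s).symm) (extChartAt (𝓡 n) s s) =
      iteratedFDeriv ℝ k (g ∘ (extChartAt (𝓡 n) s).symm) (extChartAt (𝓡 n) s s)

/-- A quasi-analytic class on the sphere: infinitely differentiable functions, each of which is
characterized within the class by its value and all its derivatives at any one point. -/
def IsQuasiAnalyticClass {n : ℕ} (𝒞 : Set (USphere n → ℝ)) : Prop :=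
  (∀ f ∈ 𝒞, ContMDiff (𝓡 n) 𝓘(ℝ, ℝ) ((⊤ : ℕ∞) : WithTop ℕ∞) f) ∧
    ∀ f ∈ 𝒞, ∀ g ∈ 𝒞, ∀ s : USphere n, SameJetAt f g s → f = g

/-! ### The random coefficients selection model -/

/-- The random elements of the model on some probability space: covariates `X`, instruments `Z`,
random coefficients `(A, B)`, and outcome `Y`. The selection indicator, the normalized
coefficients and the normalized instruments are built from them below. -/
structure SelectionModel (𝒳 : Type*) [MeasurableSpace 𝒳] (n : ℕ) where
  Ω : Type u
  mΩ : MeasurableSpace Ω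
  P : Measure Ω
  isProb : IsProbabilityMeasure P
  X : Ω → 𝒳
  Z : Ω → Fin n → ℝ
  A : Ω → ℝ
  B : Ω → Fin n → ℝ
  Y : Ω → ℝ
  measurable_X : Measurable X
  measurable_Z : Measurable Z
  measurable_A : Measurable A
  measurable_B : Measurable B
  measurable_Y : Measurable Y

attribute [instance] SelectionModel.mΩ SelectionModel.isProb

/-- The vector `(a, b)` of `ℝ^(n+1)`. -/
def consVec {n : ℕ} (a : ℝ) (b : Fin n → ℝ) : EuclideanSpace ℝ (Fin (n + 1)) :=
  WithLp.toLp 2 (Fin.cons a b)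

theorem consVec_one_ne_zero {n : ℕ} (z : Fin n → ℝ) : consVec 1 z ≠ 0 := by
  intro h
  have := congrArg (fun v : EuclideanSpace ℝ (Fin (n + 1)) => v 0) h
  simp [consVec] at this

namespace SelectionModel

variable {𝒳 : Type*} [MeasurableSpace 𝒳] {n : ℕ} (M : SelectionModel.{u} 𝒳 n)

/-- The selection indicator `R = 1{A + Bᵀ Z > 0}`. -/
def R (ω : M.Ω) : ℝ := if 0 < M.A ω + ∑ i, M.B ω i * M.Z ω i then 1 else 0

/-- The normalized random coefficients `Γ = (A, B) / ‖(A, B)‖`, and `0` if `(A, B) = 0`. -/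
def Γ (ω : M.Ω) : EuclideanSpace ℝ (Fin (n + 1)) :=
  ‖consVec (M.A ω) (M.B ω)‖⁻¹ • consVec (M.A ω) (M.B ω)

/-- The normalized instruments `S = (1, Z) / ‖(1, Z)‖`. -/
def S (ω : M.Ω) : USphere n :=
  ⟨‖consVec 1 (M.Z ω)‖⁻¹ • consVec 1 (M.Z ω), by
    rw [mem_sphere_zero_iff_norm, norm_smul, norm_inv, norm_norm]
    exact inv_mul_cancel₀ (norm_ne_zero_iff.2 (consVec_one_ne_zero _))⟩

/-- The law of the observed data: `X`, `Z` and `R` always, and `Y` only when `R = 1`. -/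
def observedLaw : Measure (𝒳 × (Fin n → ℝ) × ℝ × ℝ) :=
  M.P.map fun ω => (M.X ω, M.Z ω, M.R ω, M.R ω * M.Y ω)

/-- The conditional law of `Γ` given `X = x`. -/
def lawΓ (x : 𝒳) : Measure (EuclideanSpace ℝ (Fin (n + 1))) := condDistrib M.Γ M.X M.P x

/-- The conditional law of `Y` given `X = x`. -/
def lawY (x : 𝒳) : Measure ℝ := condDistrib M.Y M.X M.P x

/-- The conditional law of `S` given `X = x`. -/
def lawS (x : 𝒳) : Measure (USphere n) := condDistrib M.S M.X M.P x

/-- The conditional law of `(Γ, Y)` given `X = x`. -/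
def lawΓY (x : 𝒳) : Measure (EuclideanSpace ℝ (Fin (n + 1)) × ℝ) :=
  condDistrib (fun ω => (M.Γ ω, M.Y ω)) M.X M.P x

/-- The conditional law of `(S, (Γ, Y))` given `X = x`. -/
def lawSΓY (x : 𝒳) : Measure (USphere n × EuclideanSpace ℝ (Fin (n + 1)) × ℝ) :=
  condDistrib (fun ω => (M.S ω, M.Γ ω, M.Y ω)) M.X M.P x

/-- The conditional law of `(S, Y, R)` given `X = x`. -/
def lawSYR (x : 𝒳) : Measure (USphere n × ℝ × ℝ) :=
  condDistrib (fun ω => (M.S ω, M.Y ω, M.R ω)) M.X M.P x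

/-- The density with respect to `σ` of the conditional law of `Γ` given `X = x`. -/
def densΓ (x : 𝒳) (γ : USphere n) : ℝ :=
  (((M.lawΓ x).comap ((↑) : USphere n → EuclideanSpace ℝ (Fin (n + 1)))).rnDeriv
    (sphMeasure n) γ).toReal

/-- The density with respect to `σ` of the conditional law of `S` given `X = x`. -/
def densS (x : 𝒳) (s : USphere n) : ℝ := ((M.lawS x).rnDeriv (sphMeasure n) s).toReal

/-- The conditional expectation function `E[φ(Y) | X = x, Γ = γ]`. -/
def condExpΓ (φ : ℝ → ℝ) (x : 𝒳) (γ : EuclideanSpace ℝ (Fin (n + 1))) : ℝ :=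
  ∫ y, φ y ∂(condDistrib M.Y (fun ω => (M.X ω, M.Γ ω)) M.P (x, γ))

/-- The root `γ ↦ E[φ(Y) | X = x, Γ = γ] f_{Γ|X=x}(γ)`. -/
def root (φ : ℝ → ℝ) (x : 𝒳) (γ : USphere n) : ℝ := M.condExpΓ φ x γ * M.densΓ x γ

/-- `g_{φ,x}`, the hemispherical transform of the root. -/
def g (φ : ℝ → ℝ) (x : 𝒳) : USphere n → ℝ := hemispherical (M.root φ x)

/-- The maintained restrictions, for almost every `x` for the law of `X`: `Γ ≠ 0` almost surely;
`S` is independent of `(Γ, Y)`; `Γ` has a density in `L²(σ)`, which does not charge two antipodal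
points. All of them are conditional on `X = x`. -/
structure Maintained : Prop where
  Γ_ne_zero : ∀ᵐ x ∂(M.P.map M.X), M.lawΓ x {0} = 0
  indep : ∀ᵐ x ∂(M.P.map M.X), M.lawSΓY x = (M.lawS x).prod (M.lawΓY x)
  density : ∀ᵐ x ∂(M.P.map M.X),
    M.lawΓ x ≪ (sphMeasure n).map ((↑) : USphere n → EuclideanSpace ℝ (Fin (n + 1))) ∧
      MemLp (M.densΓ x) 2 (sphMeasure n)
  antipodal : ∀ᵐ x ∂(M.P.map M.X), ∀ᵐ γ ∂(sphMeasure n), M.densΓ x γ * M.densΓ x (-γ) = 0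

/-- Full support: given `X = x`, the support of `S` is `H⁺`. -/
def FullSupport : Prop :=
  ∀ᵐ x ∂(M.P.map M.X), (M.lawS x).support = upperHalfSphere n

/-- Given `X = x`, the support of `S` has nonempty interior, and `g_{φ,x}` belongs to the class
`𝒞 x` for all `φ` in `Φ x`. -/
def QuasiAnalytic (Φ : 𝒳 → Set (ℝ → ℝ)) (𝒞 : 𝒳 → Set (USphere n → ℝ)) : Prop :=
  ∀ᵐ x ∂(M.P.map M.X),
    (interior (M.lawS x).support).Nonempty ∧ ∀ φ ∈ Φ x, M.g φ x ∈ 𝒞 x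

/-- `Y` takes its values in `𝒴`, and given `X = x` the functions in `Φ x` are nonnegative almost
everywhere and integrable for the law of `Y`. -/
def Admissible (𝒴 : Set ℝ) (Φ : 𝒳 → Set (ℝ → ℝ)) : Prop :=
  (∀ᵐ ω ∂M.P, M.Y ω ∈ 𝒴) ∧
    ∀ᵐ x ∂(M.P.map M.X), ∀ φ ∈ Φ x,
      (∀ᵐ y ∂(M.lawY x), 0 ≤ φ y) ∧ Integrable φ (M.lawY x)

/-- `S` given `X = x` has a density with respect to `σ` which is positive almost everywhere
on `H⁺`. -/
def PositiveDensS : Prop :=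
  ∀ᵐ x ∂(M.P.map M.X),
    M.lawS x ≪ sphMeasure n ∧ ∀ᵐ s ∂((sphMeasure n).restrict (upperHalfSphere n)), 0 < M.densS x s

/-- The restrictions imposed on the model: the maintained ones, and either full support or the
quasi-analytic condition. -/
def Restrictions (𝒴 : Set ℝ) (Φ : 𝒳 → Set (ℝ → ℝ)) (𝒞 : 𝒳 → Set (USphere n → ℝ)) : Prop :=
  M.Maintained ∧ M.Admissible 𝒴 Φ ∧ (M.FullSupport ∨ M.QuasiAnalytic Φ 𝒞)

end SelectionModel

end

noncomputable section

/-! ### Surface measure and hemispherical transform -/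

section Sphere

open Filter Topology
open scoped Pointwise

variable {n : ℕ}

/-! Fix `x`. Since `S` is independent of `(Γ, Y)`, the mean of `φ(Y) R` given `S = s` is
`g_{φ,x}(s)`. The observed law therefore fixes `g` almost everywhere for the law of `S`, and by
continuity on its whole support (`RegularAt.g_eqOn_support`). Under full support the rest of the
sphere follows from the fact that `g(s) + g(-s)` is the constant `E[φ(Y) | X = x]`, which can be
read off at a point of the equator. In the quasi-analytic case, agreement near an interior point of
the support gives equal jets there, hence equality everywhere.

The odd part of `g` is the transform of the odd part of the root, and the transform is injective on
odd integrable functions (`ae_eq_zero_of_hemispherical_eq_zero`). The injectivity uses no harmonic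
analysis: an odd function with zero transform has integral zero over the trace of every hemisphere
on the open upper half-sphere, gnomonic projection turns these traces into affine half-spaces of
`ℝ^n`, and the Cramér–Wold theorem shows that the positive and negative parts coincide.

The root is nonnegative and vanishes at one of any two antipodal points, up to null sets, so it is
twice the positive part of its odd part (`RegularAt.root_ae_eq`). Integrating roots over `C` gives
the integrals of `φ(Y)` on `{Γ ∈ C}`, and the identifying class turns these into the joint law.

The coefficient formula is separate: reflect the lower half-sphere onto the upper one, then write
integrals over `H⁺` as expectations weighted by the inverse density of `S`. -/

instance isFiniteMeasure_sphMeasure (n : ℕ) : IsFiniteMeasure (sphMeasure n) := by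
  unfold sphMeasure; infer_instance

instance haveLebesgueDecomposition_sphMeasure (μ : Measure (USphere n)) [IsFiniteMeasure μ] :
    μ.HaveLebesgueDecomposition (sphMeasure n) := by
  have : SigmaFinite (sphMeasure n) := inferInstance
  have : SigmaFinite μ := inferInstance
  infer_instance

/-- Surface measure is, up to a factor, the volume of the cone over a set, and Lebesgue measure is
invariant under negation. -/
theorem measurePreserving_neg_sphMeasure (n : ℕ) :
    MeasurePreserving (fun θ : USphere n => -θ) (sphMeasure n) (sphMeasure n) := by
  refine ⟨continuous_neg.measurable, ?_⟩
  ext s hs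
  rw [Measure.map_apply continuous_neg.measurable hs, sphMeasure,
    Measure.toSphere_apply' _ (continuous_neg.measurable hs), Measure.toSphere_apply' _ hs]
  congr 1
  have : (Ioo (0 : ℝ) 1 • ((↑) '' ((fun θ : USphere n => -θ) ⁻¹' s)) :
      Set (EuclideanSpace ℝ (Fin (n + 1)))) = -(Ioo (0 : ℝ) 1 • ((↑) '' s)) := by
    ext x
    simp only [Set.mem_smul, Set.mem_neg, Set.mem_image, Set.mem_preimage]
    constructor
    · rintro ⟨r, hr, _, ⟨θ, hθ, rfl⟩, rfl⟩
      exact ⟨r, hr, _, ⟨-θ, hθ, rfl⟩, by simp⟩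
    · rintro ⟨r, hr, _, ⟨θ, hθ, rfl⟩, h⟩
      exact ⟨r, hr, _, ⟨-θ, by simpa using hθ, rfl⟩, by simp [h]⟩
  rw [this, Measure.measure_neg]

theorem sphMeasure_inner_eq_zero {w : EuclideanSpace ℝ (Fin (n + 1))} (hw : w ≠ 0) :
    sphMeasure n {θ : USphere n | inner ℝ w θ = 0} = 0 := by
  have hm : MeasurableSet {θ : USphere n | inner ℝ w (θ : EuclideanSpace ℝ (Fin (n + 1))) = 0} :=
    (isClosed_eq (by fun_prop) (by fun_prop)).measurableSet
  rw [sphMeasure, Measure.toSphere_apply' _ hm]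
  have h0 : (volume : Measure (EuclideanSpace ℝ (Fin (n + 1)))) ((ℝ ∙ w)ᗮ :) = 0 := by
    refine Measure.addHaar_submodule _ _ fun h => hw ?_
    have : w ∈ (ℝ ∙ w)ᗮ := h ▸ Submodule.mem_top
    exact inner_self_eq_zero.1 (Submodule.mem_orthogonal_singleton_iff_inner_right.1 this)
  rw [measure_mono_null _ h0, mul_zero]
  rintro x ⟨r, hr, _, ⟨θ, hθ, rfl⟩, rfl⟩
  simp only [SetLike.mem_coe, Submodule.mem_orthogonal_singleton_iff_inner_right]
  have : inner ℝ w (θ : EuclideanSpace ℝ (Fin (n + 1))) = 0 := hθ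
  simp [inner_smul_right, this]

theorem ae_inner_ne_zero {w : EuclideanSpace ℝ (Fin (n + 1))} (hw : w ≠ 0) :
    ∀ᵐ θ : USphere n ∂sphMeasure n, inner ℝ w (θ : EuclideanSpace ℝ (Fin (n + 1))) ≠ 0 := by
  rw [ae_iff]; simpa using sphMeasure_inner_eq_zero hw

theorem USphere.coe_ne_zero (s : USphere n) : (s : EuclideanSpace ℝ (Fin (n + 1))) ≠ 0 :=
  ne_zero_of_mem_unit_sphere s

theorem measurableSet_inner_nonneg (w : EuclideanSpace ℝ (Fin (n + 1))) :
    MeasurableSet {θ : USphere n | 0 ≤ inner ℝ w (θ : EuclideanSpace ℝ (Fin (n + 1)))} :=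
  (isClosed_le (by fun_prop) (by fun_prop)).measurableSet

theorem setOf_inner_nonneg_ae_eq_pos {w : EuclideanSpace ℝ (Fin (n + 1))} (hw : w ≠ 0) :
    {θ : USphere n | 0 ≤ inner ℝ w (θ : EuclideanSpace ℝ (Fin (n + 1)))} =ᵐ[sphMeasure n]
      {θ : USphere n | 0 < inner ℝ w (θ : EuclideanSpace ℝ (Fin (n + 1)))} := by
  filter_upwards [ae_inner_ne_zero hw] with θ hθ
  exact propext ⟨fun h => lt_of_le_of_ne h hθ.symm, le_of_lt⟩

/-- Reconciles the closed hemisphere of the transform with the strict inequality that defines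
selection; great subspheres are null. -/
theorem hemispherical_eq_setIntegral_pos (f : USphere n → ℝ) (s : USphere n) :
    hemispherical f s = ∫ θ in {θ : USphere n |
      0 < inner ℝ (s : EuclideanSpace ℝ (Fin (n + 1))) θ}, f θ ∂sphMeasure n :=
  setIntegral_congr_set (setOf_inner_nonneg_ae_eq_pos s.coe_ne_zero)

theorem setIntegral_comp_neg (f : USphere n → ℝ) (A : Set (USphere n)) :
    ∫ θ in (fun θ => -θ) ⁻¹' A, f (-θ) ∂sphMeasure n = ∫ θ in A, f θ ∂sphMeasure n :=
  (measurePreserving_neg_sphMeasure n).setIntegral_preimage_emb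
    (Homeomorph.neg (USphere n)).measurableEmbedding f A

theorem Integrable.comp_neg_sphMeasure {f : USphere n → ℝ} (hf : Integrable f (sphMeasure n)) :
    Integrable (fun θ => f (-θ)) (sphMeasure n) :=
  (measurePreserving_neg_sphMeasure n).integrable_comp_of_integrable hf

theorem hemispherical_neg (f : USphere n → ℝ) (s : USphere n) :
    hemispherical f (-s) = hemispherical (fun θ => f (-θ)) s := by
  unfold hemispherical
  rw [← setIntegral_comp_neg]
  simp

theorem hemispherical_add_hemispherical_neg {f : USphere n → ℝ}
    (hf : Integrable f (sphMeasure n)) (s : USphere n) :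
    hemispherical f s + hemispherical f (-s) = ∫ θ, f θ ∂sphMeasure n := by
  rw [hemispherical_eq_setIntegral_pos f (-s),
    ← integral_add_compl (measurableSet_inner_nonneg (s : EuclideanSpace ℝ (Fin (n + 1)))) hf]
  have : {θ : USphere n | 0 < inner ℝ ((-s : USphere n) : EuclideanSpace ℝ (Fin (n + 1))) θ} =
      {θ : USphere n | 0 ≤ inner ℝ (s : EuclideanSpace ℝ (Fin (n + 1))) θ}ᶜ := by
    ext θ
    simp
  rw [this]
  rfl

theorem hemispherical_oddPart {f : USphere n → ℝ} (hf : Integrable f (sphMeasure n)) :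
    hemispherical (oddPart f) = oddPart (hemispherical f) := by
  funext s
  rw [oddPart, hemispherical_neg]
  unfold hemispherical oddPart
  rw [integral_div, integral_sub hf.integrableOn (Integrable.comp_neg_sphMeasure hf).integrableOn]

theorem Integrable.oddPart {f : USphere n → ℝ} (hf : Integrable f (sphMeasure n)) :
    Integrable (oddPart f) (sphMeasure n) :=
  (hf.sub (Integrable.comp_neg_sphMeasure hf)).div_const 2

theorem oddPart_neg (f : USphere n → ℝ) (θ : USphere n) : oddPart f (-θ) = -oddPart f θ := by
  simp only [oddPart, neg_neg]; ring

/-- Dominated convergence: as the pole moves to `s`, the indicator at `θ` is eventually constant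
unless `θ` lies on the null set orthogonal to `s`. -/
theorem continuous_hemispherical {f : USphere n → ℝ} (hf : Integrable f (sphMeasure n)) :
    Continuous (hemispherical f) := by
  have h : hemispherical f = fun s : USphere n => ∫ θ, {θ : USphere n |
      0 ≤ inner ℝ (s : EuclideanSpace ℝ (Fin (n + 1))) θ}.indicator f θ ∂sphMeasure n := by
    funext s
    exact (integral_indicator (measurableSet_inner_nonneg _)).symm
  rw [h, continuous_iff_continuousAt]
  intro s
  refine continuousAt_of_dominated (bound := fun θ => ‖f θ‖)
    (Eventually.of_forall fun t => hf.1.indicator (measurableSet_inner_nonneg _))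
    (Eventually.of_forall fun t => Eventually.of_forall fun θ => norm_indicator_le_norm_self _ _)
    hf.norm ?_
  filter_upwards [ae_inner_ne_zero s.coe_ne_zero] with θ hθ
  have hc : ContinuousAt (fun t : USphere n =>
      inner ℝ (t : EuclideanSpace ℝ (Fin (n + 1))) (θ : EuclideanSpace ℝ (Fin (n + 1)))) s := by
    fun_prop
  rcases lt_or_gt_of_ne hθ with h | h
  · refine (continuousAt_const (y := (0 : ℝ))).congr ?_
    filter_upwards [hc.eventually_lt continuousAt_const h] with t ht
    exact (indicator_of_notMem (by simpa using ht) f).symm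
  · refine (continuousAt_const (y := f θ)).congr ?_
    filter_upwards [continuousAt_const.eventually_lt hc h] with t ht
    exact (indicator_of_mem (s := {θ : USphere n |
      0 ≤ inner ℝ (t : EuclideanSpace ℝ (Fin (n + 1))) θ}) ht.le f).symm

/-! ### Injectivity of the hemispherical transform on odd functions -/

/-- The characteristic function at `v` depends only on the image measure under the functional `inner
ℝ · v`, which half-lines determine. -/
theorem cramer_wold {F : Type*} [NormedAddCommGroup F] [InnerProductSpace ℝ F]
    [CompleteSpace F] [SecondCountableTopology F] [MeasurableSpace F] [BorelSpace F]
    {μ ν : Measure F} [IsFiniteMeasure μ] [IsFiniteMeasure ν]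
    (h : ∀ (v : F) (t : ℝ), μ {z | t ≤ inner ℝ z v} = ν {z | t ≤ inner ℝ z v}) : μ = ν := by
  refine Measure.ext_of_charFun (funext fun v => ?_)
  have hm : Measurable fun z : F => inner ℝ z v := by fun_prop
  have hmap : μ.map (fun z => inner ℝ z v) = ν.map (fun z => inner ℝ z v) := by
    refine Measure.ext_of_Ici _ _ fun t => ?_
    rw [Measure.map_apply hm measurableSet_Ici, Measure.map_apply hm measurableSet_Ici]
    exact h v t
  have key (ρ : Measure F) : charFun ρ v =
      ∫ t : ℝ, Complex.exp (t * Complex.I) ∂(ρ.map fun z => inner ℝ z v) := by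
    rw [integral_map hm.aemeasurable (by fun_prop), charFun_apply]
  rw [key, key, hmap]

/-- Turns a vanishing signed integral into equality of two positive measures, the form that
Cramér–Wold accepts. -/
theorem withDensity_ofReal_apply_eq_iff {α : Type*} [MeasurableSpace α] {μ : Measure α}
    {f : α → ℝ} (hf : Integrable f μ) {s : Set α} (hs : MeasurableSet s) :
    μ.withDensity (fun x => ENNReal.ofReal (f x)) s =
      μ.withDensity (fun x => ENNReal.ofReal (-f x)) s ↔ ∫ x in s, f x ∂μ = 0 := by
  rw [withDensity_apply _ hs, withDensity_apply _ hs,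
    integral_eq_lintegral_pos_part_sub_lintegral_neg_part hf.integrableOn, sub_eq_zero,
    ENNReal.toReal_eq_toReal_iff']
  · exact (hf.integrableOn (s := s)).lintegral_lt_top.ne
  · exact (hf.neg.integrableOn (s := s)).lintegral_lt_top.ne

/-- The gnomonic projection of the sphere. -/
def gnomonic (θ : USphere n) : EuclideanSpace ℝ (Fin n) :=
  WithLp.toLp 2 fun i => (θ : EuclideanSpace ℝ (Fin (n + 1))) i.succ /
    (θ : EuclideanSpace ℝ (Fin (n + 1))) 0

theorem continuous_coord (i : Fin (n + 1)) :
    Continuous fun θ : USphere n => (θ : EuclideanSpace ℝ (Fin (n + 1))) i := by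
  fun_prop

theorem measurable_gnomonic : Measurable (gnomonic (n := n)) := by
  have : Measurable fun θ : USphere n => fun i : Fin n =>
      (θ : EuclideanSpace ℝ (Fin (n + 1))) i.succ / (θ : EuclideanSpace ℝ (Fin (n + 1))) 0 :=
    measurable_pi_lambda _ fun i =>
      (continuous_coord i.succ).measurable.div (continuous_coord 0).measurable
  exact (WithLp.measurable_toLp 2 _).comp this

theorem continuous_consVec (a : ℝ) :
    Continuous fun z : Fin n → ℝ => consVec a z := by
  unfold consVec
  refine (PiLp.continuous_toLp 2 _).comp (continuous_pi fun i => ?_)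
  refine Fin.cases ?_ (fun j => ?_) i
  · simpa using continuous_const
  · simpa using continuous_apply j

/-- The inverse of the gnomonic projection on the open upper half-sphere. -/
def gnomonicInv (z : EuclideanSpace ℝ (Fin n)) : USphere n :=
  ⟨‖consVec 1 (WithLp.ofLp z)‖⁻¹ • consVec 1 (WithLp.ofLp z), by
    rw [mem_sphere_zero_iff_norm, norm_smul, norm_inv, norm_norm]
    exact inv_mul_cancel₀ (norm_ne_zero_iff.2 (consVec_one_ne_zero _))⟩

theorem measurable_gnomonicInv : Measurable (gnomonicInv (n := n)) := by
  have hc : Continuous fun z : EuclideanSpace ℝ (Fin n) => consVec 1 (WithLp.ofLp z) :=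
    (continuous_consVec 1).comp (PiLp.continuous_ofLp 2 _)
  exact ((hc.norm.inv₀ fun z => norm_ne_zero_iff.2 (consVec_one_ne_zero _)).smul
    hc).subtype_mk _ |>.measurable

theorem gnomonicInv_gnomonic {θ : USphere n}
    (hθ : 0 < (θ : EuclideanSpace ℝ (Fin (n + 1))) 0) : gnomonicInv (gnomonic θ) = θ := by
  have h : consVec 1 (WithLp.ofLp (gnomonic θ)) =
      ((θ : EuclideanSpace ℝ (Fin (n + 1))) 0)⁻¹ • (θ : EuclideanSpace ℝ (Fin (n + 1))) := by
    ext i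
    refine Fin.cases ?_ (fun j => ?_) i
    · simp [consVec, hθ.ne']
    · simp [consVec, gnomonic, div_eq_inv_mul]
  apply Subtype.ext
  have h1 : ‖(θ : EuclideanSpace ℝ (Fin (n + 1)))‖ = 1 := mem_sphere_zero_iff_norm.1 θ.2
  simp only [gnomonicInv, h, norm_smul, h1, smul_smul]
  rw [norm_inv, Real.norm_of_nonneg hθ.le, mul_one, inv_inv, mul_inv_cancel₀ hθ.ne', one_smul]

theorem inner_consVec (a : ℝ) (b : Fin n → ℝ) (v : EuclideanSpace ℝ (Fin (n + 1))) :
    inner ℝ (consVec a b) v = a * v 0 + ∑ i, b i * v i.succ := by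
  simp [PiLp.inner_apply, Fin.sum_univ_succ, consVec, mul_comm]

/-- Affine half-spaces in the gnomonic chart are traces of linear half-spaces; clearing the positive
denominator `θ 0` shows it. -/
theorem le_inner_gnomonic_iff {θ : USphere n} (hθ : 0 < (θ : EuclideanSpace ℝ (Fin (n + 1))) 0)
    (v : EuclideanSpace ℝ (Fin n)) (t : ℝ) :
    t ≤ inner ℝ (gnomonic θ) v ↔
      0 ≤ inner ℝ (consVec (-t) (WithLp.ofLp v)) (θ : EuclideanSpace ℝ (Fin (n + 1))) := by
  have : inner ℝ (gnomonic θ) v =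
      (∑ i, v i * (θ : EuclideanSpace ℝ (Fin (n + 1))) i.succ) /
        (θ : EuclideanSpace ℝ (Fin (n + 1))) 0 := by
    simp only [PiLp.inner_apply, gnomonic, Finset.sum_div]
    refine Finset.sum_congr rfl fun i _ => ?_
    simp [mul_div_assoc]
  rw [this, le_div_iff₀ hθ, inner_consVec]
  constructor <;> intro h <;> linarith

theorem exists_hemispherical_eq {f : USphere n → ℝ} {w : EuclideanSpace ℝ (Fin (n + 1))}
    (hw : w ≠ 0) : ∃ s : USphere n, hemispherical f s =
      ∫ θ in {θ : USphere n | 0 ≤ inner ℝ w (θ : EuclideanSpace ℝ (Fin (n + 1)))},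
        f θ ∂sphMeasure n := by
  have hpos : 0 < ‖w‖⁻¹ := inv_pos.2 (norm_pos_iff.2 hw)
  refine ⟨⟨‖w‖⁻¹ • w, by simp [norm_smul, hw]⟩, ?_⟩
  unfold hemispherical
  congr 2
  ext θ
  simp only [mem_ofPred_eq, inner_smul_left, RCLike.conj_to_real]
  exact mul_nonneg_iff_of_pos_left hpos

theorem inner_consVec_one_zero (v : EuclideanSpace ℝ (Fin (n + 1))) :
    inner ℝ (consVec 1 0) v = v 0 := by
  simp [inner_consVec]

theorem ae_coord_zero_ne_zero (n : ℕ) :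
    ∀ᵐ θ : USphere n ∂sphMeasure n, (θ : EuclideanSpace ℝ (Fin (n + 1))) 0 ≠ 0 := by
  filter_upwards [ae_inner_ne_zero (consVec_one_ne_zero (0 : Fin n → ℝ))] with θ hθ
  rwa [inner_consVec_one_zero] at hθ

/-- An odd integrable function with vanishing hemispherical transform has vanishing integral
over the intersection of every half-space with the upper half-sphere. -/
theorem setIntegral_upper_inter_eq_zero {h : USphere n → ℝ} (hi : Integrable h (sphMeasure n))
    (hodd : ∀ γ, h (-γ) = -h γ) (hH : ∀ s, hemispherical h s = 0)
    (w : EuclideanSpace ℝ (Fin (n + 1))) :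
    ∫ θ in {θ : USphere n | 0 < (θ : EuclideanSpace ℝ (Fin (n + 1))) 0} ∩
      {θ | 0 ≤ inner ℝ w (θ : EuclideanSpace ℝ (Fin (n + 1)))}, h θ ∂sphMeasure n = 0 := by
  set U : Set (USphere n) := {θ | 0 < (θ : EuclideanSpace ℝ (Fin (n + 1))) 0} with hU
  have hUm : MeasurableSet U := (isOpen_lt continuous_const (continuous_coord 0)).measurableSet
  have hU0 : ∫ θ in U, h θ ∂sphMeasure n = 0 := by
    obtain ⟨s, hs⟩ := exists_hemispherical_eq (f := h) (consVec_one_ne_zero (0 : Fin n → ℝ))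
    rw [setIntegral_congr_set (setOf_inner_nonneg_ae_eq_pos (consVec_one_ne_zero _)), hH] at hs
    simp only [inner_consVec_one_zero] at hs
    exact hs.symm
  -- The case `w = 0` does occur: it comes from `v = 0`, `t = 0` in Cramér–Wold.
  by_cases hw : w = 0
  · simpa [hw] using hU0
  set W : Set (USphere n) := {θ | 0 ≤ inner ℝ w (θ : EuclideanSpace ℝ (Fin (n + 1)))} with hW
  have hWm : MeasurableSet W := measurableSet_inner_nonneg w
  obtain ⟨s, hs⟩ := exists_hemispherical_eq (f := h) hw
  rw [hH, ← integral_inter_add_sdiff hUm hi.integrableOn] at hs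
  -- Up to null sets the reflection of `W \ U` is `U \ W`. Oddness and the zero integral over `U`
  -- then make the two pieces of the integral over `W` equal, so each vanishes.
  have h2 : ∫ θ in W \ U, h θ ∂sphMeasure n = ∫ θ in W ∩ U, h θ ∂sphMeasure n := by
    rw [← setIntegral_comp_neg]
    simp only [hodd, integral_neg]
    have hset : (fun θ : USphere n => -θ) ⁻¹' (W \ U) =ᵐ[sphMeasure n] (U \ W : Set (USphere n)) := by
      filter_upwards [ae_inner_ne_zero hw, ae_coord_zero_ne_zero n] with θ h1 h2
      refine propext ?_
      change (0 ≤ inner ℝ w (-(θ : EuclideanSpace ℝ (Fin (n + 1)))) ∧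
        ¬ 0 < -(θ : EuclideanSpace ℝ (Fin (n + 1))) 0) ↔
        (0 < (θ : EuclideanSpace ℝ (Fin (n + 1))) 0 ∧
          ¬ 0 ≤ inner ℝ w (θ : EuclideanSpace ℝ (Fin (n + 1))))
      rw [inner_neg_right]
      constructor
      · rintro ⟨a, b⟩
        exact ⟨lt_of_le_of_ne (by linarith) h2.symm, fun c => h1 (by linarith)⟩
      · rintro ⟨a, b⟩
        exact ⟨by linarith, by linarith⟩
    rw [setIntegral_congr_set hset]
    have := integral_inter_add_sdiff (μ := sphMeasure n) (f := h) (s := U) hWm hi.integrableOn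
    rw [hU0, inter_comm] at this
    linarith
  rw [h2] at hs
  rw [inter_comm]
  linarith

/-- The hemispherical transform is injective on odd integrable functions. -/
theorem ae_eq_zero_of_hemispherical_eq_zero {h : USphere n → ℝ}
    (hi : Integrable h (sphMeasure n)) (hodd : ∀ γ, h (-γ) = -h γ)
    (hH : ∀ s, hemispherical h s = 0) : h =ᵐ[sphMeasure n] 0 := by
  set U : Set (USphere n) := {θ | 0 < (θ : EuclideanSpace ℝ (Fin (n + 1))) 0} with hU
  have hUm : MeasurableSet U := (isOpen_lt continuous_const (continuous_coord 0)).measurableSet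
  set σ := (sphMeasure n).restrict U with hσ
  have hiU : Integrable h σ := hi.restrict
  set μ := σ.withDensity fun θ => ENNReal.ofReal (h θ)
  set ν := σ.withDensity fun θ => ENNReal.ofReal (-h θ)
  have : IsFiniteMeasure μ := isFiniteMeasure_withDensity_ofReal hiU.2
  have : IsFiniteMeasure ν := isFiniteMeasure_withDensity_ofReal hiU.neg.2
  have hmap : μ.map gnomonic = ν.map gnomonic := by
    refine cramer_wold fun v t => ?_
    have hm : MeasurableSet {z : EuclideanSpace ℝ (Fin n) | t ≤ inner ℝ z v} :=
      (isClosed_le (by fun_prop) (by fun_prop)).measurableSet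
    rw [Measure.map_apply measurable_gnomonic hm, Measure.map_apply measurable_gnomonic hm,
      withDensity_ofReal_apply_eq_iff hiU (measurable_gnomonic hm), hσ,
      Measure.restrict_restrict (measurable_gnomonic hm), inter_comm,
      ← setIntegral_upper_inter_eq_zero hi hodd hH (consVec (-t) (WithLp.ofLp v))]
    congr 2
    ext θ
    exact and_congr_right fun hθ => le_inner_gnomonic_iff hθ v t
  -- The projection is invertible only on `U`, which is where `μ` and `ν` live; no mass is lost in
  -- passing to the chart and back.
  have hcomp (ρ : Measure (USphere n)) (hρ : ρ ≪ σ) : (ρ.map gnomonic).map gnomonicInv = ρ := by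
    rw [Measure.map_map measurable_gnomonicInv measurable_gnomonic]
    have : gnomonicInv ∘ gnomonic =ᵐ[ρ] id := by
      refine hρ.ae_le ?_
      filter_upwards [ae_restrict_mem hUm] with θ hθ using gnomonicInv_gnomonic hθ
    rw [Measure.map_congr this, Measure.map_id]
  have hμν : μ = ν := by
    rw [← hcomp μ (withDensity_absolutelyContinuous _ _), hmap,
      hcomp ν (withDensity_absolutelyContinuous _ _)]
  have h0 : h =ᵐ[σ] 0 := by
    refine hiU.ae_eq_zero_of_forall_setIntegral_eq_zero fun s hs _ => ?_
    rw [← withDensity_ofReal_apply_eq_iff hiU hs]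
    exact congrArg (fun m => m s) hμν
  have h1 : ∀ᵐ θ ∂sphMeasure n, θ ∈ U → h θ = 0 := (ae_restrict_iff' hUm).1 h0
  filter_upwards [h1, (measurePreserving_neg_sphMeasure n).quasiMeasurePreserving.ae h1,
    ae_coord_zero_ne_zero n] with θ a b c
  rcases lt_or_gt_of_ne c with c | c
  · have hb : h (-θ) = 0 := b (by simpa [hU] using c)
    rw [hodd] at hb
    simpa using hb
  · exact a c

/-- Odd integrable functions with the same hemispherical transform agree almost everywhere. -/
theorem ae_eq_of_hemispherical_eq {h k : USphere n → ℝ}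
    (hi : Integrable h (sphMeasure n)) (ki : Integrable k (sphMeasure n))
    (hodd : ∀ γ, h (-γ) = -h γ) (kodd : ∀ γ, k (-γ) = -k γ)
    (hH : hemispherical h = hemispherical k) : h =ᵐ[sphMeasure n] k := by
  have := ae_eq_zero_of_hemispherical_eq_zero (hi.sub ki)
    (fun γ => by simp only [Pi.sub_apply, hodd, kodd]; ring) fun s => by
      have := congrFun hH s
      unfold hemispherical at this ⊢
      rw [← sub_eq_zero, ← integral_sub hi.integrableOn ki.integrableOn] at this
      exact this
  filter_upwards [this] with θ hθ
  simpa [sub_eq_zero] using hθ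

end Sphere

/-! ### Conditional laws of the model -/

/-- The selection indicator as a function of the normalized instruments and coefficients. -/
def selection {n : ℕ} (s : USphere n) (γ : EuclideanSpace ℝ (Fin (n + 1))) : ℝ :=
  {γ : EuclideanSpace ℝ (Fin (n + 1)) |
    0 < inner ℝ (s : EuclideanSpace ℝ (Fin (n + 1))) γ}.indicator 1 γ

theorem measurable_selection {n : ℕ} :
    Measurable fun w : USphere n × EuclideanSpace ℝ (Fin (n + 1)) => selection w.1 w.2 := by
  have hm : MeasurableSet {w : USphere n × EuclideanSpace ℝ (Fin (n + 1)) |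
      0 < inner ℝ (w.1 : EuclideanSpace ℝ (Fin (n + 1))) w.2} :=
    (isOpen_lt (by fun_prop) (by fun_prop)).measurableSet
  exact measurable_const.indicator hm (f := fun _ => (1 : ℝ))

theorem measurable_selection_comp {n : ℕ} {β : Type*} [MeasurableSpace β]
    {f : β → USphere n} {g : β → EuclideanSpace ℝ (Fin (n + 1))} (hf : Measurable f)
    (hg : Measurable g) : Measurable fun b => selection (f b) (g b) := by
  have h' : Measurable fun b => (f b, g b) := hf.prodMk hg
  have h := (measurable_selection (n := n)).comp h'
  unfold Function.comp at h
  exact h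

theorem selection_eq_zero_or_one {n : ℕ} (s : USphere n) (γ : EuclideanSpace ℝ (Fin (n + 1))) :
    selection s γ = 0 ∨ selection s γ = 1 := by
  by_cases h : 0 < inner ℝ (s : EuclideanSpace ℝ (Fin (n + 1))) γ
  · exact Or.inr (indicator_of_mem (by simpa using h) _)
  · exact Or.inl (indicator_of_notMem (by simpa using h) _)

namespace SelectionModel

variable {𝒳 : Type*} [MeasurableSpace 𝒳] {n : ℕ} (M : SelectionModel.{u} 𝒳 n)

instance (x : 𝒳) : IsProbabilityMeasure (M.lawΓ x) := by unfold lawΓ; infer_instance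
instance (x : 𝒳) : IsProbabilityMeasure (M.lawY x) := by unfold lawY; infer_instance
instance (x : 𝒳) : IsProbabilityMeasure (M.lawS x) := by unfold lawS; infer_instance
instance (x : 𝒳) : IsProbabilityMeasure (M.lawΓY x) := by unfold lawΓY; infer_instance
instance (x : 𝒳) : IsProbabilityMeasure (M.lawSΓY x) := by unfold lawSΓY; infer_instance

theorem measurable_Γ : Measurable M.Γ := by
  have h : Measurable fun ω => consVec (M.A ω) (M.B ω) := by
    refine (WithLp.measurable_toLp 2 _).comp (measurable_pi_lambda _ fun i => ?_)
    refine Fin.cases ?_ (fun j => ?_) i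
    · simpa using M.measurable_A
    · have h : Measurable fun ω => M.B ω j := (measurable_pi_apply j).comp M.measurable_B
      simpa using h
  exact h.norm.inv.smul h

theorem measurable_S : Measurable M.S :=
  measurable_gnomonicInv.comp ((WithLp.measurable_toLp 2 _).comp M.measurable_Z)

/-- Normalizing by positive norms keeps the sign, and when `(A, B) = 0` both strict inequalities
fail, so the identity needs no exceptional set. -/
theorem R_eq_selection (ω : M.Ω) : M.R ω = selection (M.S ω) (M.Γ ω) := by
  have hS : (M.S ω : EuclideanSpace ℝ (Fin (n + 1))) =
      ‖consVec 1 (M.Z ω)‖⁻¹ • consVec 1 (M.Z ω) := rfl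
  have hinner : inner ℝ (consVec 1 (M.Z ω)) (consVec (M.A ω) (M.B ω)) =
      M.A ω + ∑ i, M.B ω i * M.Z ω i := by
    rw [inner_consVec]
    simp [consVec, mul_comm]
  have h1 : 0 < ‖consVec 1 (M.Z ω)‖⁻¹ := inv_pos.2 (norm_pos_iff.2 (consVec_one_ne_zero _))
  have key : 0 < inner ℝ (M.S ω : EuclideanSpace ℝ (Fin (n + 1))) (M.Γ ω) ↔
      0 < M.A ω + ∑ i, M.B ω i * M.Z ω i := by
    rw [← hinner, hS, Γ, inner_smul_left, inner_smul_right, RCLike.conj_to_real,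
      mul_pos_iff_of_pos_left h1]
    by_cases h0 : consVec (M.A ω) (M.B ω) = 0
    · simp [h0]
    · exact mul_pos_iff_of_pos_left (inv_pos.2 (norm_pos_iff.2 h0))
  unfold R selection
  by_cases h : 0 < M.A ω + ∑ i, M.B ω i * M.Z ω i
  · rw [if_pos h, indicator_of_mem (by simpa using key.2 h)]; rfl
  · rw [if_neg h, indicator_of_notMem (by simpa using fun c => h (key.1 c))]

theorem measurable_R : Measurable M.R := by
  rw [funext M.R_eq_selection]
  exact measurable_selection_comp M.measurable_S M.measurable_Γ

/-- The conditional law of `(S, R, R Y)` given `X = x`. -/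
def lawObs (x : 𝒳) : Measure (USphere n × ℝ × ℝ) :=
  condDistrib (fun ω => (M.S ω, M.R ω, M.R ω * M.Y ω)) M.X M.P x

/-- The conditional laws at `x` are related as they should be, and satisfy the maintained
restrictions. -/
structure RegularAt (x : 𝒳) : Prop where
  lawΓY_eq : M.lawΓY x =
    (condDistrib M.Γ M.X M.P ⊗ₖ condDistrib M.Y (fun ω => (M.X ω, M.Γ ω)) M.P) x
  lawY_eq : M.lawY x = (M.lawΓY x).map Prod.snd
  lawSΓY_eq : M.lawSΓY x = (M.lawS x).prod (M.lawΓY x)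
  lawSYR_eq : M.lawSYR x = (M.lawSΓY x).map fun w => (w.1, w.2.2, selection w.1 w.2.1)
  lawObs_eq : M.lawObs x = (M.lawSΓY x).map fun w =>
    (w.1, selection w.1 w.2.1, selection w.1 w.2.1 * w.2.2)
  absCont : M.lawΓ x ≪ (sphMeasure n).map ((↑) : USphere n → EuclideanSpace ℝ (Fin (n + 1)))
  antipodal : ∀ᵐ γ ∂(sphMeasure n), M.densΓ x γ * M.densΓ x (-γ) = 0

theorem condDistrib_prodMk_ae_eq {α β Ω Ω' : Type*} [MeasurableSpace α] [MeasurableSpace β]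
    [MeasurableSpace Ω] [StandardBorelSpace Ω] [Nonempty Ω]
    [MeasurableSpace Ω'] [StandardBorelSpace Ω'] [Nonempty Ω']
    (μ : Measure α) [IsFiniteMeasure μ] {X : α → β} {Y : α → Ω} {Z : α → Ω'}
    (hX : Measurable X) (hY : Measurable Y) (hZ : Measurable Z) :
    condDistrib (fun a => (Y a, Z a)) X μ =ᵐ[μ.map X]
      condDistrib Y X μ ⊗ₖ condDistrib Z (fun a => (X a, Y a)) μ := by
  refine condDistrib_ae_eq_of_measure_eq_compProd _ (hY.prodMk hZ).aemeasurable ?_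
  rw [← Measure.compProd_assoc', compProd_map_condDistrib hY.aemeasurable,
    compProd_map_condDistrib hZ.aemeasurable, Measure.map_map (by fun_prop) (by fun_prop)]
  rfl

/-- Everything about versions of conditional laws is settled here. `RegularAt` does not mention `φ`,
so a single null set of `x` serves all of `Φ x`, countable or not. -/
theorem Maintained.ae_regularAt {M : SelectionModel.{u} 𝒳 n} (hM : M.Maintained) :
    ∀ᵐ x ∂(M.P.map M.X), M.RegularAt x := by
  have hΓY := condDistrib_prodMk_ae_eq M.P M.measurable_X M.measurable_Γ M.measurable_Y
  have hY := condDistrib_comp (mβ := ‹MeasurableSpace 𝒳›) (μ := M.P) M.X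
    (M.measurable_Γ.prodMk M.measurable_Y).aemeasurable measurable_snd
  have hmS : Measurable fun ω => (M.S ω, M.Γ ω, M.Y ω) :=
    M.measurable_S.prodMk (M.measurable_Γ.prodMk M.measurable_Y)
  have hsel : Measurable fun w : USphere n × EuclideanSpace ℝ (Fin (n + 1)) × ℝ =>
      selection w.1 w.2.1 := measurable_selection_comp (by fun_prop) (by fun_prop)
  have hf₁ : Measurable fun w : USphere n × EuclideanSpace ℝ (Fin (n + 1)) × ℝ =>
      (w.1, w.2.2, selection w.1 w.2.1) := by fun_prop
  have hf₂ : Measurable fun w : USphere n × EuclideanSpace ℝ (Fin (n + 1)) × ℝ =>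
      (w.1, selection w.1 w.2.1, selection w.1 w.2.1 * w.2.2) := by fun_prop
  have hSYR := condDistrib_comp (mβ := ‹MeasurableSpace 𝒳›) (μ := M.P) M.X hmS.aemeasurable hf₁
  have hObs := condDistrib_comp (mβ := ‹MeasurableSpace 𝒳›) (μ := M.P) M.X hmS.aemeasurable hf₂
  filter_upwards [hΓY, hY, hSYR, hObs, hM.indep, hM.density, hM.antipodal] with x a b c d e f g
  refine ⟨a, ?_, e, ?_, ?_, f.1, g⟩
  · rw [Kernel.map_apply _ measurable_snd] at b
    exact b
  · rw [Kernel.map_apply _ hf₁] at c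
    rw [lawSYR, funext M.R_eq_selection]
    exact c
  · rw [Kernel.map_apply _ hf₂] at d
    simp only [lawObs, R_eq_selection]
    exact d

/-! ### What the observed law determines directly -/

section Observed

variable (M₁ : SelectionModel.{u} 𝒳 n) (M₂ : SelectionModel.{v} 𝒳 n)

theorem map_X_eq_map_observedLaw : M.P.map M.X = M.observedLaw.map Prod.fst := by
  have := M.measurable_X
  have := M.measurable_Z
  have := M.measurable_R
  have := M.measurable_Y
  rw [observedLaw, Measure.map_map (by fun_prop) (by fun_prop)]
  rfl

theorem map_X_S_R_eq_map_observedLaw :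
    M.P.map (fun ω => (M.X ω, M.S ω, M.R ω, M.R ω * M.Y ω)) =
      M.observedLaw.map fun w => (w.1, gnomonicInv (WithLp.toLp 2 w.2.1), w.2.2) := by
  have := M.measurable_X
  have := M.measurable_Z
  have := M.measurable_R
  have := M.measurable_Y
  have h : Measurable fun w : 𝒳 × (Fin n → ℝ) × ℝ × ℝ => gnomonicInv (WithLp.toLp 2 w.2.1) :=
    (measurable_gnomonicInv.comp (WithLp.measurable_toLp 2 _)).comp (by fun_prop)
  rw [observedLaw, Measure.map_map (by fun_prop) (by fun_prop)]
  rfl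

theorem map_X_S_eq_map_observedLaw :
    M.P.map (fun ω => (M.X ω, M.S ω)) =
      M.observedLaw.map fun w => (w.1, gnomonicInv (WithLp.toLp 2 w.2.1)) := by
  have := M.measurable_X
  have := M.measurable_Z
  have := M.measurable_R
  have := M.measurable_Y
  have h : Measurable fun w : 𝒳 × (Fin n → ℝ) × ℝ × ℝ => gnomonicInv (WithLp.toLp 2 w.2.1) :=
    (measurable_gnomonicInv.comp (WithLp.measurable_toLp 2 _)).comp (by fun_prop)
  rw [observedLaw, Measure.map_map (by fun_prop) (by fun_prop)]
  rfl

variable {M₁ M₂}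

theorem map_X_eq_of_observedLaw_eq (h : M₁.observedLaw = M₂.observedLaw) :
    M₁.P.map M₁.X = M₂.P.map M₂.X := by
  rw [map_X_eq_map_observedLaw, map_X_eq_map_observedLaw, h]

/-- `condDistrib` is built from the joint law alone, so equality holds for every `x`, not just
almost every one. -/
theorem lawObs_eq_of_observedLaw_eq (h : M₁.observedLaw = M₂.observedLaw) (x : 𝒳) :
    M₁.lawObs x = M₂.lawObs x := by
  rw [lawObs, lawObs, condDistrib, condDistrib]
  simp only [map_X_S_R_eq_map_observedLaw, h]

theorem lawS_eq_of_observedLaw_eq (h : M₁.observedLaw = M₂.observedLaw) (x : 𝒳) :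
    M₁.lawS x = M₂.lawS x := by
  rw [lawS, lawS, condDistrib, condDistrib]
  simp only [map_X_S_eq_map_observedLaw, h]

end Observed

/-! ### The root as a density -/


theorem measurableEmbedding_coe_sphere (n : ℕ) :
    MeasurableEmbedding ((↑) : USphere n → EuclideanSpace ℝ (Fin (n + 1))) :=
  MeasurableEmbedding.subtype_coe Metric.isClosed_sphere.measurableSet

/-- The conditional law of `Γ` given `X = x`, as a measure on the sphere. -/
def sphΓ (x : 𝒳) : Measure (USphere n) :=
  (M.lawΓ x).comap ((↑) : USphere n → EuclideanSpace ℝ (Fin (n + 1)))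

instance (x : 𝒳) : IsFiniteMeasure (M.sphΓ x) := by
  refine ⟨?_⟩
  rw [sphΓ, (measurableEmbedding_coe_sphere n).comap_apply]
  exact measure_lt_top _ _

/-- Absolute continuity forces the law to be carried by the sphere, so restricting it there loses no
mass. -/
theorem RegularAt.map_sphΓ {M : SelectionModel.{u} 𝒳 n} {x : 𝒳} (hx : M.RegularAt x) :
    (M.sphΓ x).map ((↑) : USphere n → EuclideanSpace ℝ (Fin (n + 1))) = M.lawΓ x := by
  rw [sphΓ, (measurableEmbedding_coe_sphere n).map_comap, Measure.restrict_eq_self_of_ae_mem]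
  refine hx.absCont.ae_le ?_
  change ∀ᵐ γ ∂((sphMeasure n).map _), γ ∈ range _
  rw [(measurableEmbedding_coe_sphere n).ae_map_iff]
  exact Filter.Eventually.of_forall fun γ => mem_range_self γ

theorem RegularAt.sphΓ_absolutelyContinuous {M : SelectionModel.{u} 𝒳 n} {x : 𝒳}
    (hx : M.RegularAt x) : M.sphΓ x ≪ sphMeasure n := by
  intro s hs
  rw [sphΓ, (measurableEmbedding_coe_sphere n).comap_apply]
  refine hx.absCont ?_
  rw [(measurableEmbedding_coe_sphere n).map_apply,
    preimage_image_eq _ Subtype.val_injective, hs]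

section Root

variable {M} {x : 𝒳} {φ : ℝ → ℝ}

theorem RegularAt.integrable_comp_snd (hx : M.RegularAt x) (hφm : Measurable φ)
    (hφ : Integrable φ (M.lawY x)) : Integrable (fun w => φ w.2) (M.lawΓY x) := by
  rw [hx.lawY_eq] at hφ
  exact (integrable_map_measure hφm.aestronglyMeasurable measurable_snd.aemeasurable).1 hφ

theorem RegularAt.integrable_root (hx : M.RegularAt x) (hφm : Measurable φ)
    (hφ : Integrable φ (M.lawY x)) : Integrable (M.root φ x) (sphMeasure n) := by
  have h := hx.integrable_comp_snd hφm hφ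
  rw [hx.lawΓY_eq] at h
  have h2 : Integrable (M.condExpΓ φ x) (M.lawΓ x) := h.integral_compProd
  rw [← hx.map_sphΓ, (measurableEmbedding_coe_sphere n).integrable_map_iff] at h2
  rw [← integrable_toReal_rnDeriv_mul_iff hx.sphΓ_absolutelyContinuous] at h2
  refine h2.congr (Filter.Eventually.of_forall fun γ => ?_)
  exact mul_comm _ _

/-- Disintegrate over `Γ`, then replace the law of `Γ` by its density. This makes the root the
density of the law of `Γ` weighted by `φ(Y)`. -/
theorem RegularAt.setIntegral_root (hx : M.RegularAt x) (hφm : Measurable φ)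
    (hφ : Integrable φ (M.lawY x)) {D : Set (EuclideanSpace ℝ (Fin (n + 1)))}
    (hD : MeasurableSet D) :
    ∫ γ in ((↑) : USphere n → EuclideanSpace ℝ (Fin (n + 1))) ⁻¹' D, M.root φ x γ ∂sphMeasure n =
      ∫ w in D ×ˢ univ, φ w.2 ∂M.lawΓY x := by
  have h := hx.integrable_comp_snd hφm hφ
  rw [hx.lawΓY_eq] at h ⊢
  rw [setIntegral_compProd_univ_right _ hD h.integrableOn]
  change _ = ∫ γ in D, M.condExpΓ φ x γ ∂M.lawΓ x
  rw [← hx.map_sphΓ, (measurableEmbedding_coe_sphere n).setIntegral_map,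
    ← setIntegral_toReal_rnDeriv_mul hx.sphΓ_absolutelyContinuous
      ((measurableEmbedding_coe_sphere n).measurable hD)]
  refine integral_congr_ae (Filter.Eventually.of_forall fun γ => ?_)
  exact mul_comm _ _

theorem RegularAt.integral_root (hx : M.RegularAt x) (hφm : Measurable φ)
    (hφ : Integrable φ (M.lawY x)) :
    ∫ γ, M.root φ x γ ∂sphMeasure n = ∫ y, φ y ∂M.lawY x := by
  have h := hx.setIntegral_root hφm hφ MeasurableSet.univ
  rw [preimage_univ, univ_prod_univ, setIntegral_univ, setIntegral_univ] at h
  rw [h, hx.lawY_eq, integral_map measurable_snd.aemeasurable hφm.aestronglyMeasurable]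

theorem RegularAt.root_nonneg (hx : M.RegularAt x) (hφm : Measurable φ)
    (hφ : Integrable φ (M.lawY x)) (h0 : ∀ᵐ y ∂M.lawY x, 0 ≤ φ y) :
    ∀ᵐ γ ∂sphMeasure n, 0 ≤ M.root φ x γ := by
  refine ae_nonneg_of_forall_setIntegral_nonneg (hx.integrable_root hφm hφ) fun s hs _ => ?_
  rw [← preimage_image_eq s (Subtype.val_injective :
      Function.Injective ((↑) : USphere n → EuclideanSpace ℝ (Fin (n + 1)))),
    hx.setIntegral_root hφm hφ ((measurableEmbedding_coe_sphere n).measurableSet_image.2 hs)]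
  refine setIntegral_nonneg_of_ae ?_
  rw [hx.lawY_eq] at h0
  exact ae_of_ae_map measurable_snd.aemeasurable h0

/-- A nonnegative root which does not charge two antipodal points is determined by its odd
part. -/
theorem RegularAt.root_ae_eq (hx : M.RegularAt x) (hφm : Measurable φ)
    (hφ : Integrable φ (M.lawY x)) (h0 : ∀ᵐ y ∂M.lawY x, 0 ≤ φ y) :
    M.root φ x =ᵐ[sphMeasure n] fun γ =>
      if 0 < oddPart (M.root φ x) γ then 2 * oddPart (M.root φ x) γ else 0 := by
  have h1 := hx.root_nonneg hφm hφ h0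
  filter_upwards [h1, (measurePreserving_neg_sphMeasure n).quasiMeasurePreserving.ae h1,
    hx.antipodal] with γ a b c
  -- The root carries the density as a factor, so it inherits the antipodal condition.
  have hor : M.root φ x γ = 0 ∨ M.root φ x (-γ) = 0 := by
    rcases mul_eq_zero.1 c with c | c
    · exact Or.inl (by simp [root, c])
    · exact Or.inr (by simp [root, c])
  unfold oddPart
  split_ifs with hpos <;> rcases hor with h | h <;> linarith

/-- The value of `g_{φ,x}` at `s` is the integral of `φ(Y)` over the event of selection. -/
theorem RegularAt.g_eq (hx : M.RegularAt x) (hφm : Measurable φ)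
    (hφ : Integrable φ (M.lawY x)) (s : USphere n) :
    M.g φ x s = ∫ w, selection s w.1 * φ w.2 ∂M.lawΓY x := by
  have hm : MeasurableSet {γ : EuclideanSpace ℝ (Fin (n + 1)) |
      0 < inner ℝ (s : EuclideanSpace ℝ (Fin (n + 1))) γ} :=
    (isOpen_lt (by fun_prop) (by fun_prop)).measurableSet
  rw [g, hemispherical_eq_setIntegral_pos]
  refine (hx.setIntegral_root hφm hφ hm).trans ?_
  rw [← integral_indicator (hm.prod MeasurableSet.univ)]
  congr 1 with w
  by_cases h : 0 < inner ℝ (s : EuclideanSpace ℝ (Fin (n + 1))) w.1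
  · simp [selection, indicator, h]
  · simp [selection, indicator, h]

theorem RegularAt.continuous_g (hx : M.RegularAt x) (hφm : Measurable φ)
    (hφ : Integrable φ (M.lawY x)) : Continuous (M.g φ x) :=
  continuous_hemispherical (hx.integrable_root hφm hφ)

theorem RegularAt.g_add_g_neg (hx : M.RegularAt x) (hφm : Measurable φ)
    (hφ : Integrable φ (M.lawY x)) (s : USphere n) :
    M.g φ x s + M.g φ x (-s) = ∫ y, φ y ∂M.lawY x := by
  rw [g, hemispherical_add_hemispherical_neg (hx.integrable_root hφm hφ),
    hx.integral_root hφm hφ]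

theorem norm_selection_le (s : USphere n) (γ : EuclideanSpace ℝ (Fin (n + 1))) :
    ‖selection s γ‖ ≤ 1 := by
  rcases selection_eq_zero_or_one s γ with h | h <;> simp [h]

theorem RegularAt.integrable_mul_selection (hx : M.RegularAt x) (hφm : Measurable φ)
    (hφ : Integrable φ (M.lawY x)) {k : USphere n → ℝ} (hk : Integrable k (M.lawS x)) :
    Integrable (fun w : USphere n × EuclideanSpace ℝ (Fin (n + 1)) × ℝ =>
      k w.1 * (selection w.1 w.2.1 * φ w.2.2)) ((M.lawS x).prod (M.lawΓY x)) := by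
  have h := hk.mul_prod (hx.integrable_comp_snd hφm hφ)
  have hsel : Measurable fun w : USphere n × EuclideanSpace ℝ (Fin (n + 1)) × ℝ =>
      selection w.1 w.2.1 := measurable_selection_comp (by fun_prop) (by fun_prop)
  refine (h.bdd_mul (c := 1) hsel.aestronglyMeasurable
    (Filter.Eventually.of_forall fun w => norm_selection_le _ _)).congr
    (Filter.Eventually.of_forall fun w => ?_)
  simp only
  ring

theorem RegularAt.integral_mul_selection (hx : M.RegularAt x) (hφm : Measurable φ)
    (hφ : Integrable φ (M.lawY x)) {k : USphere n → ℝ} (hk : Integrable k (M.lawS x)) :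
    ∫ w, k w.1 * (selection w.1 w.2.1 * φ w.2.2) ∂(M.lawS x).prod (M.lawΓY x) =
      ∫ s, k s * M.g φ x s ∂M.lawS x := by
  rw [integral_prod _ (hx.integrable_mul_selection hφm hφ hk)]
  simp only [integral_const_mul, hx.g_eq hφm hφ]

/-- The integrals of `g_{φ,x}` against the law of the instruments are observed. -/
theorem RegularAt.setIntegral_g (hx : M.RegularAt x) (hφm : Measurable φ)
    (hφ : Integrable φ (M.lawY x)) {D : Set (USphere n)} (hD : MeasurableSet D) :
    ∫ s in D, M.g φ x s ∂M.lawS x =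
      ∫ w, D.indicator 1 w.1 * (w.2.1 * φ w.2.2) ∂M.lawObs x := by
  have hk : Integrable (D.indicator 1 : USphere n → ℝ) (M.lawS x) :=
    (integrable_const (1 : ℝ)).indicator hD
  have hsel : Measurable fun w : USphere n × EuclideanSpace ℝ (Fin (n + 1)) × ℝ =>
      selection w.1 w.2.1 := measurable_selection_comp (by fun_prop) (by fun_prop)
  have hDm : Measurable (D.indicator 1 : USphere n → ℝ) := measurable_one.indicator hD
  rw [hx.lawObs_eq, hx.lawSΓY_eq, integral_map (by fun_prop) (by fun_prop)]
  -- Observing `R Y` in place of `Y` costs nothing after multiplication by `R`, which is 0 or 1.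
  have : ∀ w : USphere n × EuclideanSpace ℝ (Fin (n + 1)) × ℝ,
      selection w.1 w.2.1 * φ (selection w.1 w.2.1 * w.2.2) = selection w.1 w.2.1 * φ w.2.2 := by
    intro w
    rcases selection_eq_zero_or_one w.1 w.2.1 with h | h <;> simp [h]
  simp only [this]
  rw [hx.integral_mul_selection hφm hφ hk, ← integral_indicator hD]
  congr 1 with s
  by_cases h : s ∈ D <;> simp [h]

end Root

end SelectionModel

/-! ### Parity of the Gegenbauer polynomials -/

theorem gegenbauer_neg (μ : ℝ) (k : ℕ) (t : ℝ) :
    gegenbauer μ k (-t) = (-1) ^ k * gegenbauer μ k t := by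
  induction k using Nat.twoStepInduction with
  | zero => simp [gegenbauer]
  | one => unfold gegenbauer; split_ifs <;> ring
  | more k h0 h1 =>
    rw [gegenbauer, gegenbauer, h0, h1]
    ring

theorem continuous_gegenbauer (μ : ℝ) (k : ℕ) : Continuous (gegenbauer μ k) := by
  induction k using Nat.twoStepInduction with
  | zero =>
    have : gegenbauer μ 0 = fun _ => 1 := by funext t; simp [gegenbauer]
    rw [this]; fun_prop
  | one =>
    have : gegenbauer μ 1 = fun t => if μ = 0 then 2 * t else 2 * μ * t := by
      funext t; simp [gegenbauer]
    rw [this]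
    by_cases h : μ = 0 <;> simp only [h, if_true, if_false] <;> fun_prop
  | more k h0 h1 =>
    have : gegenbauer μ (k + 2) = fun t => (2 * (μ + k + 1) * t * gegenbauer μ (k + 1) t
        - (if μ = 0 ∧ k = 0 then 2 else 2 * μ + k) * gegenbauer μ k t) / (k + 2) := by
      funext t; rw [gegenbauer]
    rw [this]
    fun_prop

theorem continuous_zonalKernel (n k : ℕ) : Continuous (zonalKernel n k) := by
  have := continuous_gegenbauer (((n + 1 : ℝ) - 2) / 2) k
  unfold zonalKernel
  fun_prop

/-- Oddness and continuity are all that the coefficient formula needs from the kernel. -/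
theorem zonalKernel_odd_neg (n p : ℕ) (t : ℝ) :
    zonalKernel n (2 * p + 1) (-t) = -zonalKernel n (2 * p + 1) t := by
  unfold zonalKernel
  rw [gegenbauer_neg]
  simp [pow_succ, pow_mul, neg_div]

/-! ### Jets -/

theorem SameJetAt.of_eventuallyEq {n : ℕ} {f g : USphere n → ℝ} {s : USphere n}
    (h : f =ᶠ[nhds s] g) : SameJetAt f g s := by
  intro k
  have hc := continuousAt_extChartAt_symm (I := 𝓡 n) s
  have : (f ∘ (extChartAt (𝓡 n) s).symm) =ᶠ[nhds (extChartAt (𝓡 n) s s)]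
      (g ∘ (extChartAt (𝓡 n) s).symm) := by
    have ht : Filter.Tendsto (extChartAt (𝓡 n) s).symm (nhds (extChartAt (𝓡 n) s s))
        (nhds s) := by
      have := hc.tendsto
      rwa [extChartAt_to_inv] at this
    exact ht.eventually h
  exact (this.iteratedFDeriv ℝ k).self_of_nhds

/-! ### Half-spheres -/

theorem measurableSet_upperHalfSphere (n : ℕ) : MeasurableSet (upperHalfSphere n) :=
  (isClosed_le continuous_const (continuous_coord 0)).measurableSet

theorem neg_preimage_compl_upperHalfSphere_ae_eq (n : ℕ) :
    ((fun s : USphere n => -s) ⁻¹' (upperHalfSphere n)ᶜ) =ᵐ[sphMeasure n]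
      upperHalfSphere n := by
  filter_upwards [ae_coord_zero_ne_zero n] with s hs
  refine propext ?_
  change ¬ (0 ≤ -(s : EuclideanSpace ℝ (Fin (n + 1))) 0) ↔
    0 ≤ (s : EuclideanSpace ℝ (Fin (n + 1))) 0
  rw [Left.nonneg_neg_iff, not_le]
  exact ⟨le_of_lt, fun h => lt_of_le_of_ne h hs.symm⟩

theorem exists_coord_zero_eq_zero {n : ℕ} (hn : 1 ≤ n) :
    ∃ s : USphere n, (s : EuclideanSpace ℝ (Fin (n + 1))) 0 = 0 := by
  refine ⟨⟨EuclideanSpace.single (Fin.last n) 1, by simp⟩, ?_⟩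
  have : (0 : Fin (n + 1)) ≠ Fin.last n := by
    intro h
    have := congrArg Fin.val h
    simp at this
    omega
  simp [this]

theorem integrable_of_continuous {α : Type*} [TopologicalSpace α] [CompactSpace α]
    [MeasurableSpace α] [OpensMeasurableSpace α] (μ : Measure α) [IsFiniteMeasure μ]
    {f : α → ℝ} (hf : Continuous f) : Integrable f μ :=
  hf.integrable_of_hasCompactSupport (HasCompactSupport.of_compactSpace f)

namespace SelectionModel

variable {𝒳 : Type*} [MeasurableSpace 𝒳] {n : ℕ}

/-! ### Comparison of two models at a fixed `x` -/

section Identification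

variable {M₁ : SelectionModel.{u} 𝒳 n} {M₂ : SelectionModel.{v} 𝒳 n} {x : 𝒳} {φ : ℝ → ℝ}

/-- The observed law determines `g_{φ,x}` on the support of the instruments. -/
theorem RegularAt.g_eqOn_support (h₁ : M₁.RegularAt x) (h₂ : M₂.RegularAt x)
    (hφm : Measurable φ) (hφ₁ : Integrable φ (M₁.lawY x)) (hφ₂ : Integrable φ (M₂.lawY x))
    (hS : M₁.lawS x = M₂.lawS x) (hO : M₁.lawObs x = M₂.lawObs x) :
    EqOn (M₁.g φ x) (M₂.g φ x) (M₁.lawS x).support := by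
  have c₁ := h₁.continuous_g hφm hφ₁
  have c₂ := h₂.continuous_g hφm hφ₂
  have hae : M₁.g φ x =ᵐ[M₁.lawS x] M₂.g φ x := by
    refine Integrable.ae_eq_of_forall_setIntegral_eq _ _ (integrable_of_continuous _ c₁)
      (integrable_of_continuous _ c₂) fun D hD _ => ?_
    rw [h₁.setIntegral_g hφm hφ₁ hD, hO, hS, h₂.setIntegral_g hφm hφ₂ hD]
  intro s hs
  by_contra hne
  -- A disagreement at a support point would persist on a neighbourhood, which has positive mass.
  have hopen : IsOpen {t | M₁.g φ x t ≠ M₂.g φ x t} := isOpen_ne_fun c₁ c₂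
  exact ((Measure.mem_support_iff_forall s).1 hs _ (hopen.mem_nhds hne)).ne' (ae_iff.1 hae)

/-- An equatorial point and its antipode both lie in `H⁺`, so the sum `g(s) + g(-s)` is known there;
being constant, it gives `g` on the lower half-sphere. -/
theorem RegularAt.g_eq_of_eqOn_upperHalfSphere (hn : 1 ≤ n) (h₁ : M₁.RegularAt x)
    (h₂ : M₂.RegularAt x) (hφm : Measurable φ) (hφ₁ : Integrable φ (M₁.lawY x))
    (hφ₂ : Integrable φ (M₂.lawY x))
    (h : EqOn (M₁.g φ x) (M₂.g φ x) (upperHalfSphere n)) : M₁.g φ x = M₂.g φ x := by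
  obtain ⟨e, he⟩ := exists_coord_zero_eq_zero hn
  have hT : ∫ y, φ y ∂M₁.lawY x = ∫ y, φ y ∂M₂.lawY x := by
    rw [← h₁.g_add_g_neg hφm hφ₁ e, ← h₂.g_add_g_neg hφm hφ₂ e,
      h (show e ∈ upperHalfSphere n from he.ge),
      h (show -e ∈ upperHalfSphere n by simp [upperHalfSphere, he])]
  funext s
  by_cases hs : s ∈ upperHalfSphere n
  · exact h hs
  · have hs' : -s ∈ upperHalfSphere n := by
      simp only [upperHalfSphere, mem_ofPred_eq, not_le] at hs
      simpa [upperHalfSphere] using hs.le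
    have a := h₁.g_add_g_neg hφm hφ₁ s
    have b := h₂.g_add_g_neg hφm hφ₂ s
    rw [hT] at a
    have c := h hs'
    linarith

theorem RegularAt.oddPart_root_ae_eq (h₁ : M₁.RegularAt x) (h₂ : M₂.RegularAt x)
    (hφm : Measurable φ) (hφ₁ : Integrable φ (M₁.lawY x)) (hφ₂ : Integrable φ (M₂.lawY x))
    (hg : M₁.g φ x = M₂.g φ x) :
    oddPart (M₁.root φ x) =ᵐ[sphMeasure n] oddPart (M₂.root φ x) := by
  have i₁ := h₁.integrable_root hφm hφ₁
  have i₂ := h₂.integrable_root hφm hφ₂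
  refine ae_eq_of_hemispherical_eq (Integrable.oddPart i₁) (Integrable.oddPart i₂)
    (oddPart_neg _) (oddPart_neg _) ?_
  rw [hemispherical_oddPart i₁, hemispherical_oddPart i₂]
  exact congrArg oddPart hg

/-- The roots for the functions of an identifying class determine the joint law of the
coefficients and the outcome. -/
theorem RegularAt.lawΓY_eq_of_root_ae_eq {𝒴 : Set ℝ} (h𝒴 : MeasurableSet 𝒴) {Ψ : Set (ℝ → ℝ)}
    (hΨ : IsIdentifyingClass 𝒴 Ψ) (h₁ : M₁.RegularAt x) (h₂ : M₂.RegularAt x)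
    (hφ₁ : ∀ φ ∈ Ψ, Integrable φ (M₁.lawY x)) (hφ₂ : ∀ φ ∈ Ψ, Integrable φ (M₂.lawY x))
    (hY₁ : M₁.lawY x 𝒴ᶜ = 0) (hY₂ : M₂.lawY x 𝒴ᶜ = 0)
    (h : ∀ φ ∈ Ψ, M₁.root φ x =ᵐ[sphMeasure n] M₂.root φ x) :
    M₁.lawΓY x = M₂.lawΓY x := by
  have hnull {N : Measure (EuclideanSpace ℝ (Fin (n + 1)) × ℝ)}
      (hN : N.map Prod.snd 𝒴ᶜ = 0) (C : Set (EuclideanSpace ℝ (Fin (n + 1)) × ℝ)) :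
      (N.restrict C).map Prod.snd 𝒴ᶜ = 0 := by
    rw [Measure.map_apply measurable_snd h𝒴.compl] at hN ⊢
    exact Measure.absolutelyContinuous_of_le Measure.restrict_le_self hN
  refine Measure.ext_prod fun {C D} hC hD => ?_
  -- For fixed `C` these are the finite laws of `Y` on `{Γ ∈ C}`, carried by `𝒴`; the identifying
  -- class applies to them one `C` at a time.
  have key : ((M₁.lawΓY x).restrict (C ×ˢ univ)).map Prod.snd =
      ((M₂.lawΓY x).restrict (C ×ˢ univ)).map Prod.snd := by
    refine hΨ.2 _ _ inferInstance inferInstance (hnull (h₁.lawY_eq ▸ hY₁) _)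
      (hnull (h₂.lawY_eq ▸ hY₂) _) fun φ hφ => ?_
    have hφm := hΨ.1 φ hφ
    have a₁ := h₁.integrable_comp_snd hφm (hφ₁ φ hφ)
    have a₂ := h₂.integrable_comp_snd hφm (hφ₂ φ hφ)
    refine ⟨(integrable_map_measure hφm.aestronglyMeasurable measurable_snd.aemeasurable).2
        a₁.restrict,
      (integrable_map_measure hφm.aestronglyMeasurable measurable_snd.aemeasurable).2
        a₂.restrict, ?_⟩
    rw [integral_map measurable_snd.aemeasurable hφm.aestronglyMeasurable,
      integral_map measurable_snd.aemeasurable hφm.aestronglyMeasurable,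
      ← h₁.setIntegral_root hφm (hφ₁ φ hφ) hC, ← h₂.setIntegral_root hφm (hφ₂ φ hφ) hC]
    exact integral_congr_ae (ae_restrict_of_ae (h φ hφ))
  have := congrArg (fun m => m D) key
  simp only [Measure.map_apply measurable_snd hD,
    Measure.restrict_apply (measurable_snd hD)] at this
  have hset : (Prod.snd ⁻¹' D ∩ C ×ˢ univ : Set (EuclideanSpace ℝ (Fin (n + 1)) × ℝ)) =
      C ×ˢ D := by
    ext w
    simp [and_comm]
  rwa [hset] at this

end Identification

/-! ### Coefficients as inverse-density weighted expectations -/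

section Coefficients

variable {M : SelectionModel.{u} 𝒳 n} {x : 𝒳} {φ : ℝ → ℝ}

theorem ae_lawY_compl_eq_zero (M : SelectionModel.{u} 𝒳 n) {𝒴 : Set ℝ}
    (h𝒴 : MeasurableSet 𝒴) (h : ∀ᵐ ω ∂M.P, M.Y ω ∈ 𝒴) :
    ∀ᵐ x ∂(M.P.map M.X), M.lawY x 𝒴ᶜ = 0 := by
  have h1 : ∀ᵐ p ∂(M.P.map fun ω => (M.X ω, M.Y ω)), p.2 ∈ 𝒴 :=
    (ae_map_iff (M.measurable_X.prodMk M.measurable_Y).aemeasurable (measurable_snd h𝒴)).2 h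
  rw [← compProd_map_condDistrib M.measurable_Y.aemeasurable] at h1
  exact Measure.ae_ae_of_ae_compProd h1

theorem RegularAt.integral_mul_g_eq (hx : M.RegularAt x) (hφm : Measurable φ)
    (hφ : Integrable φ (M.lawY x)) {q : USphere n → ℝ} (hq : Continuous q)
    (hodd : ∀ s, q (-s) = -q s) :
    ∫ s, q s * M.g φ x s ∂sphMeasure n =
      2 * ∫ s in upperHalfSphere n, q s * M.g φ x s ∂sphMeasure n
        - (∫ y, φ y ∂M.lawY x) * ∫ s in upperHalfSphere n, q s ∂sphMeasure n := by
  have hg := hx.continuous_g hφm hφ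
  have hqg : Integrable (fun s => q s * M.g φ x s) (sphMeasure n) :=
    integrable_of_continuous _ (hq.mul hg)
  have h2 : ∫ s in (upperHalfSphere n)ᶜ, q s * M.g φ x s ∂sphMeasure n =
      ∫ s in upperHalfSphere n, (q s * M.g φ x s - (∫ y, φ y ∂M.lawY x) * q s) ∂sphMeasure n := by
    -- With `E` the constant `g(s) + g(-s)`, oddness gives `q(-s) g(-s) = q(s) g(s) - E q(s)`.
    rw [← setIntegral_comp_neg,
      setIntegral_congr_set (neg_preimage_compl_upperHalfSphere_ae_eq n)]
    congr 1 with s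
    rw [hodd, ← hx.g_add_g_neg hφm hφ s]
    ring
  rw [← integral_add_compl (measurableSet_upperHalfSphere n) hqg, h2,
    integral_sub hqg.integrableOn
      ((integrable_of_continuous _ hq).const_mul _).integrableOn, integral_const_mul]
  ring

theorem measurable_densS (M : SelectionModel.{u} 𝒳 n) (x : 𝒳) : Measurable (M.densS x) :=
  (Measure.measurable_rnDeriv _ _).ennreal_toReal

theorem ae_densS_eq_zero (habs : M.lawS x ≪ sphMeasure n)
    (hsupp : (M.lawS x).support = upperHalfSphere n) :
    ∀ᵐ s ∂sphMeasure n, s ∉ upperHalfSphere n → M.densS x s = 0 := by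
  have h0 : M.lawS x (upperHalfSphere n)ᶜ = 0 := hsupp ▸ Measure.measure_compl_support
  rw [← Measure.setLIntegral_rnDeriv habs, lintegral_eq_zero_iff (Measure.measurable_rnDeriv _ _),
    Filter.EventuallyEq, ae_restrict_iff' (measurableSet_upperHalfSphere n).compl] at h0
  filter_upwards [h0] with s hs hmem
  simp [densS, hs hmem]

theorem integrable_div_densS (habs : M.lawS x ≪ sphMeasure n) {q : USphere n → ℝ}
    (hq : Continuous q) : Integrable (fun s => q s / M.densS x s) (M.lawS x) := by
  rw [← integrable_toReal_rnDeriv_mul_iff habs]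
  have hd := M.measurable_densS x
  refine (integrable_of_continuous (sphMeasure n) hq).mono
    (hd.mul (hq.measurable.div hd)).aestronglyMeasurable
    (Filter.Eventually.of_forall fun s => ?_)
  change ‖M.densS x s * (q s / M.densS x s)‖ ≤ ‖q s‖
  -- Where the density vanishes the quotient is 0 by convention, so the weighted integrand stays
  -- bounded by `q`.
  by_cases h : M.densS x s = 0
  · simp [h]
  · rw [mul_div_cancel₀ _ h]

/-- The density cancels on `H⁺`, where it is positive, and kills the integrand off `H⁺`, outside the
support. -/
theorem integral_div_densS_mul (habs : M.lawS x ≪ sphMeasure n)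
    (hsupp : (M.lawS x).support = upperHalfSphere n)
    (hpos : ∀ᵐ s ∂((sphMeasure n).restrict (upperHalfSphere n)), 0 < M.densS x s)
    (q k : USphere n → ℝ) :
    ∫ s, q s / M.densS x s * k s ∂M.lawS x =
      ∫ s in upperHalfSphere n, q s * k s ∂sphMeasure n := by
  rw [← integral_toReal_rnDeriv_mul habs, ← integral_indicator (measurableSet_upperHalfSphere n)]
  rw [ae_restrict_iff' (measurableSet_upperHalfSphere n)] at hpos
  refine integral_congr_ae ?_
  filter_upwards [hpos, ae_densS_eq_zero habs hsupp] with s h1 h2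
  change M.densS x s * _ = _
  by_cases hs : s ∈ upperHalfSphere n
  · rw [indicator_of_mem hs, ← mul_assoc, mul_div_cancel₀ _ (h1 hs).ne']
  · rw [indicator_of_notMem hs, h2 hs, zero_mul]

theorem RegularAt.integrable_lawSYR (hx : M.RegularAt x) (hφm : Measurable φ)
    (hφ : Integrable φ (M.lawY x)) (habs : M.lawS x ≪ sphMeasure n) {q : USphere n → ℝ}
    (hq : Continuous q) :
    Integrable (fun w : USphere n × ℝ × ℝ => q w.1 / M.densS x w.1 * φ w.2.1 * w.2.2)
      (M.lawSYR x) := by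
  have hd := M.measurable_densS x
  have hqm := hq.measurable
  have hsel : Measurable fun w : USphere n × EuclideanSpace ℝ (Fin (n + 1)) × ℝ =>
      selection w.1 w.2.1 := measurable_selection_comp (by fun_prop) (by fun_prop)
  rw [hx.lawSYR_eq, hx.lawSΓY_eq, integrable_map_measure (by fun_prop) (by fun_prop)]
  refine (hx.integrable_mul_selection hφm hφ (integrable_div_densS habs hq)).congr
    (Filter.Eventually.of_forall fun w => ?_)
  simp only [Function.comp_apply]
  ring

theorem RegularAt.integral_lawSYR (hx : M.RegularAt x) (hφm : Measurable φ)
    (hφ : Integrable φ (M.lawY x)) (habs : M.lawS x ≪ sphMeasure n)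
    (hsupp : (M.lawS x).support = upperHalfSphere n)
    (hpos : ∀ᵐ s ∂((sphMeasure n).restrict (upperHalfSphere n)), 0 < M.densS x s)
    {q : USphere n → ℝ} (hq : Continuous q) :
    ∫ w : USphere n × ℝ × ℝ, q w.1 / M.densS x w.1 * φ w.2.1 * w.2.2 ∂M.lawSYR x =
      ∫ s in upperHalfSphere n, q s * M.g φ x s ∂sphMeasure n := by
  have hd := M.measurable_densS x
  have hqm := hq.measurable
  have hsel : Measurable fun w : USphere n × EuclideanSpace ℝ (Fin (n + 1)) × ℝ =>
      selection w.1 w.2.1 := measurable_selection_comp (by fun_prop) (by fun_prop)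
  rw [← integral_div_densS_mul habs hsupp hpos,
    ← hx.integral_mul_selection hφm hφ (integrable_div_densS habs hq),
    hx.lawSYR_eq, hx.lawSΓY_eq, integral_map (by fun_prop) (by fun_prop)]
  congr 1 with w
  ring

end Coefficients

/-- Under the restrictions, the observed law determines `g_{φ,x}`. -/
theorem ae_g_eq_of_observedLaw_eq (hn : 1 ≤ n) {𝒴 : Set ℝ} {Φ : 𝒳 → Set (ℝ → ℝ)}
    (hΦ : ∀ x, IsIdentifyingClass 𝒴 (Φ x)) {𝒞 : 𝒳 → Set (USphere n → ℝ)}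
    (h𝒞 : ∀ x, IsQuasiAnalyticClass (𝒞 x))
    {M₁ : SelectionModel.{u} 𝒳 n} {M₂ : SelectionModel.{v} 𝒳 n}
    (h₁ : M₁.Restrictions 𝒴 Φ 𝒞) (h₂ : M₂.Restrictions 𝒴 Φ 𝒞)
    (hobs : M₁.observedLaw = M₂.observedLaw) :
    ∀ᵐ x ∂(M₁.P.map M₁.X), ∀ φ ∈ Φ x, M₁.g φ x = M₂.g φ x := by
  obtain ⟨m₁, a₁, s₁⟩ := h₁
  obtain ⟨m₂, a₂, s₂⟩ := h₂
  have hX := map_X_eq_of_observedLaw_eq hobs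
  have r₂ := m₂.ae_regularAt
  have b₂ := a₂.2
  rw [← hX] at r₂ b₂
  -- The models may satisfy different alternatives. The law of `S` is observed, so full support of
  -- one passes to the other; otherwise both are quasi-analytic.
  have hcase : (∀ᵐ x ∂(M₁.P.map M₁.X), (M₁.lawS x).support = upperHalfSphere n) ∨
      (∀ᵐ x ∂(M₁.P.map M₁.X), (interior (M₁.lawS x).support).Nonempty ∧
        ∀ φ ∈ Φ x, M₁.g φ x ∈ 𝒞 x ∧ M₂.g φ x ∈ 𝒞 x) := by
    rcases s₁ with s₁ | s₁
    · exact Or.inl s₁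
    · rcases s₂ with s₂ | s₂
      · left
        simpa only [FullSupport, ← hX, ← lawS_eq_of_observedLaw_eq hobs] using s₂
      · right
        rw [QuasiAnalytic, ← hX] at s₂
        filter_upwards [s₁, s₂] with x c₁ c₂
        exact ⟨c₁.1, fun φ hφ => ⟨c₁.2 φ hφ, c₂.2 φ hφ⟩⟩
  rcases hcase with hf | hq
  · filter_upwards [m₁.ae_regularAt, r₂, a₁.2, b₂, hf] with x h₁ h₂ i₁ i₂ hs φ hφ
    have hφm := (hΦ x).1 φ hφ
    refine h₁.g_eq_of_eqOn_upperHalfSphere hn h₂ hφm (i₁ φ hφ).2 (i₂ φ hφ).2 ?_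
    rw [← hs]
    exact h₁.g_eqOn_support h₂ hφm (i₁ φ hφ).2 (i₂ φ hφ).2
      (lawS_eq_of_observedLaw_eq hobs x) (lawObs_eq_of_observedLaw_eq hobs x)
  · filter_upwards [m₁.ae_regularAt, r₂, a₁.2, b₂, hq] with x h₁ h₂ i₁ i₂ hs φ hφ
    have hφm := (hΦ x).1 φ hφ
    have heq := h₁.g_eqOn_support h₂ hφm (i₁ φ hφ).2 (i₂ φ hφ).2
      (lawS_eq_of_observedLaw_eq hobs x) (lawObs_eq_of_observedLaw_eq hobs x)
    obtain ⟨⟨s, hs⟩, hmem⟩ := hs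
    refine (h𝒞 x).2 _ (hmem φ hφ).1 _ (hmem φ hφ).2 s (SameJetAt.of_eventuallyEq ?_)
    filter_upwards [isOpen_interior.mem_nhds hs] with t ht using heq (interior_subset ht)

end SelectionModel

end

theorem theorem3 {𝒳 : Type*} [MeasurableSpace 𝒳] {n : ℕ} (hn : 1 ≤ n)
    (𝒴 : Set ℝ) (h𝒴 : MeasurableSet 𝒴)
    (Φ : 𝒳 → Set (ℝ → ℝ)) (hΦ : ∀ x, IsIdentifyingClass 𝒴 (Φ x))
    (𝒞 : 𝒳 → Set (USphere n → ℝ)) (h𝒞 : ∀ x, IsQuasiAnalyticClass (𝒞 x)) :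
    -- identification: two models with the same observed data have the same odd parts of the
    -- roots and the same conditional law of the coefficients and the outcome
    (∀ (M₁ : SelectionModel.{u} 𝒳 n) (M₂ : SelectionModel.{v} 𝒳 n),
      M₁.Restrictions 𝒴 Φ 𝒞 → M₂.Restrictions 𝒴 Φ 𝒞 → M₁.observedLaw = M₂.observedLaw →
        (∀ᵐ x ∂(M₁.P.map M₁.X), ∀ φ ∈ Φ x,
          oddPart (M₁.root φ x) =ᵐ[sphMeasure n] oddPart (M₂.root φ x)) ∧
        (∀ᵐ x ∂(M₁.P.map M₁.X), M₁.lawΓY x = M₂.lawΓY x)) ∧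
    -- inversion of the hemispherical transform
    (∀ M : SelectionModel.{u} 𝒳 n, M.Restrictions 𝒴 Φ 𝒞 →
      ∀ᵐ x ∂(M.P.map M.X), ∀ φ ∈ Φ x,
        hemispherical (oddPart (M.root φ x)) = oddPart (M.g φ x) ∧
        (∀ h : USphere n → ℝ, Integrable h (sphMeasure n) → (∀ γ, h (-γ) = -h γ) →
          hemispherical h = oddPart (M.g φ x) → h =ᵐ[sphMeasure n] oddPart (M.root φ x)) ∧
        M.root φ x =ᵐ[sphMeasure n] fun γ =>
          if 0 < oddPart (M.root φ x) γ then 2 * oddPart (M.root φ x) γ else 0) ∧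
    -- the Gegenbauer coefficients
    (∀ M : SelectionModel.{u} 𝒳 n,
      M.Maintained → M.Admissible 𝒴 Φ → M.FullSupport → M.PositiveDensS →
      ∀ᵐ x ∂(M.P.map M.X), ∀ φ ∈ Φ x, ∀ (γ : USphere n) (p : ℕ),
        Integrable (fun s : USphere n => zonalKernel n (2 * p + 1)
          (inner ℝ (γ : EuclideanSpace ℝ (Fin (n + 1))) s) * M.g φ x s) (sphMeasure n) ∧
        Integrable (fun w : USphere n × ℝ × ℝ => zonalKernel n (2 * p + 1)
          (inner ℝ (γ : EuclideanSpace ℝ (Fin (n + 1))) w.1) / M.densS x w.1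
            * φ w.2.1 * w.2.2) (M.lawSYR x) ∧
        ∫ s : USphere n, zonalKernel n (2 * p + 1)
            (inner ℝ (γ : EuclideanSpace ℝ (Fin (n + 1))) s) * M.g φ x s ∂(sphMeasure n) =
          2 * ∫ w, zonalKernel n (2 * p + 1)
              (inner ℝ (γ : EuclideanSpace ℝ (Fin (n + 1))) w.1) / M.densS x w.1
                * φ w.2.1 * w.2.2 ∂(M.lawSYR x)
            - (∫ y, φ y ∂(M.lawY x)) *
              ∫ s in upperHalfSphere n, zonalKernel n (2 * p + 1)
                (inner ℝ (γ : EuclideanSpace ℝ (Fin (n + 1))) s) ∂(sphMeasure n)) := by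
  refine ⟨fun M₁ M₂ h₁ h₂ hobs => ?_, fun M hM => ?_, fun M hm ha hfull hdens => ?_⟩
  · have hX := SelectionModel.map_X_eq_of_observedLaw_eq hobs
    have hg := SelectionModel.ae_g_eq_of_observedLaw_eq hn hΦ h𝒞 h₁ h₂ hobs
    have r₂ := h₂.1.ae_regularAt
    have b₂ := h₂.2.1.2
    have y₂ := M₂.ae_lawY_compl_eq_zero h𝒴 h₂.2.1.1
    rw [← hX] at r₂ b₂ y₂
    have hodd : ∀ᵐ x ∂(M₁.P.map M₁.X), ∀ φ ∈ Φ x,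
        oddPart (M₁.root φ x) =ᵐ[sphMeasure n] oddPart (M₂.root φ x) := by
      filter_upwards [h₁.1.ae_regularAt, r₂, h₁.2.1.2, b₂, hg] with x e₁ e₂ i₁ i₂ hg φ hφ
      exact e₁.oddPart_root_ae_eq e₂ ((hΦ x).1 φ hφ) (i₁ φ hφ).2 (i₂ φ hφ).2 (hg φ hφ)
    refine ⟨hodd, ?_⟩
    filter_upwards [h₁.1.ae_regularAt, r₂, h₁.2.1.2, b₂, hodd,
      M₁.ae_lawY_compl_eq_zero h𝒴 h₁.2.1.1, y₂] with x e₁ e₂ i₁ i₂ ho y₁ y₂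
    refine e₁.lawΓY_eq_of_root_ae_eq h𝒴 (hΦ x) e₂ (fun φ hφ => (i₁ φ hφ).2)
      (fun φ hφ => (i₂ φ hφ).2) y₁ y₂ fun φ hφ => ?_
    have hφm := (hΦ x).1 φ hφ
    filter_upwards [e₁.root_ae_eq hφm (i₁ φ hφ).2 (i₁ φ hφ).1,
      e₂.root_ae_eq hφm (i₂ φ hφ).2 (i₂ φ hφ).1, ho φ hφ] with γ c₁ c₂ c
    rw [c₁, c₂, c]
  · filter_upwards [hM.1.ae_regularAt, hM.2.1.2] with x e i φ hφ
    have hφm := (hΦ x).1 φ hφ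
    have hr := e.integrable_root hφm (i φ hφ).2
    refine ⟨hemispherical_oddPart hr, fun h hi hodd hH => ?_,
      e.root_ae_eq hφm (i φ hφ).2 (i φ hφ).1⟩
    exact ae_eq_of_hemispherical_eq hi (Integrable.oddPart hr) hodd (oddPart_neg _)
      (hH.trans (hemispherical_oddPart hr).symm)
  · filter_upwards [hm.ae_regularAt, ha.2, hfull, hdens] with x e i hs hd φ hφ γ p
    have hφm := (hΦ x).1 φ hφ
    have hq : Continuous fun s : USphere n => zonalKernel n (2 * p + 1)
        (inner ℝ (γ : EuclideanSpace ℝ (Fin (n + 1))) s) :=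
      (continuous_zonalKernel n (2 * p + 1)).comp (by fun_prop)
    refine ⟨integrable_of_continuous _ (hq.mul (e.continuous_g hφm (i φ hφ).2)),
      e.integrable_lawSYR hφm (i φ hφ).2 hd.1 hq, ?_⟩
    rw [e.integral_mul_g_eq hφm (i φ hφ).2 hq, e.integral_lawSYR hφm (i φ hφ).2 hd.1 hs hd.2 hq]
    intro s
    simp only [coe_neg_sphere, inner_neg_right, zonalKernel_odd_neg]
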